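/- Let $\mathbb{K}$ be a field and let $n, r \ge 0$ be integers. Let $v_1,\dots,v_n$ be the standard basis of $\mathbb{Z}^n$ and let $\Psi_n\subset\mathbb{Z}^n$ be the submonoid generated by the vectors $v_i-v_{i+1}$, $1\le i\le n-1$. Let $sl_n^+$ be the Lie algebra of strictly upper triangular complex $n\times n$ matrices, with standard basis $e_{ij}$ ($1\le i<j\le n$), let $\mathfrak{A}_n(\mathbb{Z})$ be the Kostant form of its universal enveloping algebra, i.e. the subring generated by the divided powers $e_{ij}^{(k)}=\frac{1}{k!}e_{ij}^k$, and let $\mathfrak{A}_n(\mathbb{K})=\mathbb{K}\otimes_{\mathbb{Z}}\mathfrak{A}_n(\mathbb{Z})$, which is $\Psi_n$-graded with $\deg e_{ij}^{(k)}=k(v_i-v_j)$. Let $B_n=\operatorname{Maps}(\mathbb{Z}^n,\mathbb{K})$ with pointwise operations, on which $\Psi_n$ acts by $f^{\gamma}(z)=f(\gamma+z)$, and let $\mathfrak{C}_n(\mathbb{K})=\mathfrak{A}_n(\mathbb{K})\ltimes_{\Psi_n}B_n$ be the skew product, i.e. the vector space $\mathfrak{A}_n(\mathbb{K})\otimes_{\mathbb{K}}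 B_n$ with the multiplication $$(a\otimes f)(a'\otimes f')=aa'\otimes f^{\gamma}f'\qquad\text{for } a'\in\mathfrak{A}_n(\mathbb{K})_{\gamma},\ \gamma\in\Psi_n.$$ We write $af$ for $a\otimes f$, and $\chi_\mu\in B_n$ for the indicator function of the point $\mu\in\mathbb{Z}^n$. Let $\Lambda(n,r)\subset\mathbb{Z}^n$ be the set of all $(z_1,\dots,z_n)$ with all $z_i\ge 0$ and $\sum_i z_i=r$, let $\chi$ be its indicator function, $e=1\otimes\chi$ and $\bar e=1-e$. For $\lambda,\mu\in\mathbb{Z}^n$ write $\lambda\trianglerighteq\mu$ if $\sum_{i\le j}\lambda_i\ge\sum_{i\le j}\mu_i$ for all $j$, and let $T(\lambda,\mu)$ be the set of upper triangular $n\times n$ matrices $(k_{ij})$ over $\mathbb{N}=\{0,1,2,\dots\}$ with row sums $\sum_{j\ge i}k_{ij}=\lambda_i$ and column sums $\sum_{i\le j}k_{ij}=\mu_j$. A two-sided ideal $I$ of a ring $R$ is called strong idempotent if for all left $R/I$-modules $X,Y$ and all $i\ge1$ the natural map $\operatorname{Ext}^i_{R/I}(X,Y)\to\operatorname{Ext}^i_R(X,Y)$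 is an isomorphism. **Theorem.** The ideal $\mathfrak{C}_n(\mathbb{K})\,\bar e\,\mathfrak{C}_n(\mathbb{K})$ of $\mathfrak{C}_n(\mathbb{K})$ is strong idempotent, and the (classes of the) elements $$\prod_{i<j}e_{ij}^{(k_{ij})}\chi_\mu,\qquad \lambda,\mu\in\Lambda(n,r),\ \lambda\trianglerighteq\mu,\ (k_{ij})\in T(\lambda,\mu),$$ form a $\mathbb{K}$-basis of $\mathfrak{C}_n(\Lambda(n,r))=\mathfrak{C}_n(\mathbb{K})/\mathfrak{C}_n(\mathbb{K})\,\bar e\,\mathfrak{C}_n(\mathbb{K})$ (distinct triples $(\lambda,\mu,(k_{ij}))$ giving distinct elements). Here the product is ordered so that $e_{ij}$ stands to the left of $e_{i'j'}$ if $j>j'$, or if $j=j'$ and $i>i'$; for example, for $n=3$ it is $e_{23}^{(k_{23})}e_{13}^{(k_{13})}e_{12}^{(k_{12})}\chi_\mu$. -/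

import Mathlib

open scoped TensorProduct DirectSum
open CategoryTheory

universe u v w

section RestrictScalars

variable {R : Type u} [Ring R] {S : Type v} [Ring S] (f : R →+* S)

lemma restrictScalars_map_exact (T : ShortComplex (ModuleCat.{w} S)) (h : T.Exact) :
    (T.map (ModuleCat.restrictScalars.{w} f)).Exact := by
  rw [CategoryTheory.ShortComplex.ShortExact.moduleCat_exact_iff_function_exact] at h ⊢
  exact h

instance restrictScalars_preservesFiniteLimits :
    Limits.PreservesFiniteLimits (ModuleCat.restrictScalars.{w} f) := by
  have := ((CategoryTheory.Functor.exact_tfae (ModuleCat.restrictScalars.{w} f)).out 1 3).mp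
    (restrictScalars_map_exact f)
  exact this.1

instance restrictScalars_preservesFiniteColimits :
    Limits.PreservesFiniteColimits (ModuleCat.restrictScalars.{w} f) := by
  have := ((CategoryTheory.Functor.exact_tfae (ModuleCat.restrictScalars.{w} f)).out 1 3).mp
    (restrictScalars_map_exact f)
  exact this.2

end RestrictScalars

/-- A two-sided ideal `I` of `R` is `k`-idempotent if the natural maps
`Ext^i_{R/I}(X, Y) → Ext^i_R(X, Y)` induced by the inclusion of `R/I`-modules into `R`-modules are
isomorphisms for all `R/I`-modules `X`, `Y` and `1 ≤ i ≤ k`. -/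
def IsKIdempotentIdeal {R : Type u} [Ring R] (I : Ideal R) [I.IsTwoSided] (k : ℕ) : Prop :=
  ∀ (X Y : ModuleCat.{u} (R ⧸ I)) (i : ℕ), 1 ≤ i → i ≤ k →
    Function.Bijective
      ((ModuleCat.restrictScalars.{u} (Ideal.Quotient.mk I)).mapExtAddHom X Y i)

/-- A two-sided ideal is strong idempotent if it is `k`-idempotent for all `k`. -/
def IsStrongIdempotentIdeal {R : Type u} [Ring R] (I : Ideal R) [I.IsTwoSided] : Prop :=
  ∀ k : ℕ, IsKIdempotentIdeal I k

section Skew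

variable {K Γ A B : Type*} [CommRing K] [AddCommMonoid Γ] [DecidableEq Γ]
  [Ring A] [Algebra K A] [Ring B] [Algebra K B]

/-- The underlying space of the skew product `A ⋉_Γ B` of a `Γ`-graded algebra `A` and an algebra
`B` on which `Γ` acts by algebra endomorphisms `b ↦ b ^ γ`. -/
def SkewProduct (_𝒜 : Γ → Submodule K A) (_act : Multiplicative Γ →* (B →ₐ[K] B)) : Type _ :=
  A ⊗[K] B

namespace SkewProduct

variable (𝒜 : Γ → Submodule K A) [GradedAlgebra 𝒜] (act : Multiplicative Γ →* (B →ₐ[K] B))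

instance : AddCommGroup (SkewProduct 𝒜 act) := inferInstanceAs (AddCommGroup (A ⊗[K] B))
instance : Module K (SkewProduct 𝒜 act) := inferInstanceAs (Module K (A ⊗[K] B))

/-- The element `a ⊗ b` of `A ⋉_Γ B`. -/
def tmul (a : A) (b : B) : SkewProduct 𝒜 act := a ⊗ₜ[K] b

/-- The interchange map `b ⊗ a ↦ a ⊗ b ^ γ` for `a` of degree `γ`. -/
noncomputable def interchange : B →ₗ[K] A →ₗ[K] A ⊗[K] B :=
  LinearMap.flip
    ((DirectSum.toModule K Γ (B →ₗ[K] A ⊗[K] B) fun γ =>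
      ((TensorProduct.mk K A B).compl₂ (act (Multiplicative.ofAdd γ)).toLinearMap) ∘ₗ
        (𝒜 γ).subtype) ∘ₗ (DirectSum.decomposeLinearEquiv 𝒜).toLinearMap)

lemma interchange_of_mem {γ : Γ} {a : A} (ha : a ∈ 𝒜 γ) (b : B) :
    interchange 𝒜 act b a = a ⊗ₜ[K] act (Multiplicative.ofAdd γ) b := by
  have h : DirectSum.decomposeLinearEquiv 𝒜 a = DirectSum.lof K Γ (fun γ => 𝒜 γ) γ ⟨a, ha⟩ :=
    DirectSum.decompose_of_mem 𝒜 ha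
  simp only [interchange, LinearMap.flip_apply, LinearMap.comp_apply, LinearEquiv.coe_coe, h,
    DirectSum.toModule_lof]
  rfl

/-- `(a ⊗ b) (a' ⊗ b') = (m_A ⊗ m_B) (a ⊗ T (b ⊗ a') ⊗ b')`. -/
noncomputable def mulMap : A ⊗[K] B →ₗ[K] A ⊗[K] B →ₗ[K] A ⊗[K] B :=
  TensorProduct.curry <|
    TensorProduct.map (LinearMap.mul' K A) (LinearMap.mul' K B) ∘ₗ
    (TensorProduct.assoc K A A (B ⊗[K] B)).symm.toLinearMap ∘ₗ
    LinearMap.lTensor A ((TensorProduct.assoc K A B B).toLinearMap ∘ₗ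
      LinearMap.rTensor B (TensorProduct.lift (interchange 𝒜 act)) ∘ₗ
      (TensorProduct.assoc K B A B).symm.toLinearMap) ∘ₗ
    (TensorProduct.assoc K A B (A ⊗[K] B)).toLinearMap

lemma mulMap_tmul {γ : Γ} (a : A) (b : B) {a' : A} (ha' : a' ∈ 𝒜 γ) (b' : B) :
    mulMap 𝒜 act (a ⊗ₜ b) (a' ⊗ₜ b') =
      (a * a') ⊗ₜ[K] (act (Multiplicative.ofAdd γ) b * b') := by
  simp [mulMap, interchange_of_mem 𝒜 act ha']

lemma homogeneous_induction {P : A ⊗[K] B → Prop} (h0 : P 0)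
    (ht : ∀ (γ : Γ) (a : A) (_ : a ∈ 𝒜 γ) (b : B), P (a ⊗ₜ b))
    (hadd : ∀ x y, P x → P y → P (x + y)) (x : A ⊗[K] B) : P x := by
  induction x with
  | zero => exact h0
  | add x y hx hy => exact hadd x y hx hy
  | tmul a b =>
    induction a using DirectSum.Decomposition.inductionOn 𝒜 with
    | zero => simpa using h0
    | homogeneous m => exact ht _ _ m.2 _
    | add m m' hm hm' => rw [TensorProduct.add_tmul]; exact hadd _ _ hm hm'

lemma mulMap_assoc (x y z : A ⊗[K] B) :
    mulMap 𝒜 act (mulMap 𝒜 act x y) z = mulMap 𝒜 act x (mulMap 𝒜 act y z) := by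
  induction z using homogeneous_induction 𝒜 with
  | h0 => simp
  | hadd z z' hz hz' => simp only [map_add, hz, hz']
  | ht γ c hc b₃ =>
    induction y using homogeneous_induction 𝒜 with
    | h0 => simp
    | hadd y y' hy hy' => simp only [map_add, LinearMap.add_apply, hy, hy']
    | ht δ b hb b₂ =>
      induction x with
      | zero => simp
      | add x x' hx hx' => simp only [map_add, LinearMap.add_apply, hx, hx']
      | tmul a b₁ =>
        rw [mulMap_tmul 𝒜 act a b₁ hb, mulMap_tmul 𝒜 act _ _ hc, mulMap_tmul 𝒜 act _ _ hc,
          mulMap_tmul 𝒜 act _ _ (SetLike.mul_mem_graded hb hc), add_comm δ γ, ofAdd_add,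
          map_mul act]
        simp [mul_assoc]

lemma one_mulMap (x : A ⊗[K] B) : mulMap 𝒜 act (1 ⊗ₜ 1) x = x := by
  induction x using homogeneous_induction 𝒜 with
  | h0 => simp
  | hadd z z' hz hz' => simp only [map_add, hz, hz']
  | ht γ c hc b => rw [mulMap_tmul 𝒜 act _ _ hc]; simp

lemma mulMap_one (x : A ⊗[K] B) : mulMap 𝒜 act x (1 ⊗ₜ 1) = x := by
  induction x with
  | zero => simp
  | add x x' hx hx' => simp only [map_add, LinearMap.add_apply, hx, hx']
  | tmul a b => rw [mulMap_tmul 𝒜 act _ _ SetLike.GradedOne.one_mem]; simp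

noncomputable instance : Mul (SkewProduct 𝒜 act) := ⟨fun x y => mulMap 𝒜 act x y⟩
instance : One (SkewProduct 𝒜 act) := ⟨tmul 𝒜 act 1 1⟩

noncomputable instance : Ring (SkewProduct 𝒜 act) :=
  { (inferInstance : AddCommGroup (SkewProduct 𝒜 act)) with
    mul := (· * ·)
    one := 1
    mul_assoc := mulMap_assoc 𝒜 act
    one_mul := one_mulMap 𝒜 act
    mul_one := mulMap_one 𝒜 act
    zero_mul := fun x => LinearMap.map_zero₂ (mulMap 𝒜 act) x
    mul_zero := fun x => map_zero (mulMap 𝒜 act x)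
    left_distrib := fun x y z => map_add (mulMap 𝒜 act x) y z
    right_distrib := fun x y z => LinearMap.map_add₂ (mulMap 𝒜 act) x y z }

noncomputable instance : Algebra K (SkewProduct 𝒜 act) :=
  Algebra.ofModule (fun r x y => LinearMap.map_smul₂ (mulMap 𝒜 act) r x y)
    (fun r x y => map_smul (mulMap 𝒜 act x) r y)

lemma tmul_mul_tmul {γ : Γ} (a : A) (b : B) {a' : A} (ha' : a' ∈ 𝒜 γ) (b' : B) :
    tmul 𝒜 act a b * tmul 𝒜 act a' b' =
      tmul 𝒜 act (a * a') (act (Multiplicative.ofAdd γ) b * b') :=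
  mulMap_tmul 𝒜 act a b ha' b'

end SkewProduct
end Skew

section LieAlgebra

attribute [local instance 100] LieRing.ofAssociativeRing

/-- The Lie algebra `sl_n^+` of strictly upper triangular complex matrices. -/
def slPlus (n : ℕ) : LieSubalgebra ℂ (Matrix (Fin n) (Fin n) ℂ) where
  carrier := {M | ∀ i j, j ≤ i → M i j = 0}
  add_mem' hM hN i j h := by simp [hM i j h, hN i j h]
  zero_mem' := by simp
  smul_mem' c M hM i j h := by simp [hM i j h]
  lie_mem' := by
    have key : ∀ M N : Matrix (Fin n) (Fin n) ℂ, (∀ i j, j ≤ i → M i j = 0) →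
        (∀ i j, j ≤ i → N i j = 0) → ∀ i j, j ≤ i → (M * N) i j = 0 := by
      intro M N hM hN i j h
      rw [Matrix.mul_apply]
      refine Finset.sum_eq_zero fun k _ => ?_
      rcases le_or_gt k i with hk | hk
      · rw [hM i k hk, zero_mul]
      · rw [hN k j (h.trans hk.le), mul_zero]
    intro M N hM hN i j h
    rw [Ring.lie_def, Matrix.sub_apply, key M N hM hN i j h, key N M hN hM i j h, sub_zero]

/-- The pairs `(i, j)` with `i < j`. -/
abbrev PosRoot (n : ℕ) : Type := {p : Fin n × Fin n // p.1 < p.2}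

/-- The standard basis vector `e_{ij}` of `sl_n^+`. -/
def slPlus.e {n : ℕ} (p : PosRoot n) : slPlus n :=
  ⟨Matrix.single p.1.1 p.1.2 1, fun i j h => Matrix.single_apply_of_ne _ _ _ _ _ (by
    rintro ⟨rfl, rfl⟩; exact absurd p.2 (not_lt.mpr h))⟩

/-- The universal enveloping algebra of `sl_n^+` over `ℂ`. -/
abbrev EnvAlg (n : ℕ) : Type := UniversalEnvelopingAlgebra ℂ (slPlus n)

/-- `e_{ij}` in the universal enveloping algebra. -/
noncomputable def EnvAlg.e {n : ℕ} (p : PosRoot n) : EnvAlg n :=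
  UniversalEnvelopingAlgebra.ι ℂ (slPlus.e p)

/-- The submonoid `Ψ_n` of `ℤ^n` generated by the `v_i - v_{i+1}`. -/
def Psi (n : ℕ) : AddSubmonoid (Fin n → ℤ) :=
  AddSubmonoid.closure {x | ∃ i j : Fin n, (i : ℕ) + 1 = j ∧ x = Pi.single i 1 - Pi.single j 1}

lemma sub_mem_Psi {n : ℕ} (i j : Fin n) (h : i < j) :
    (Pi.single i 1 - Pi.single j 1 : Fin n → ℤ) ∈ Psi n := by
  obtain ⟨d, hd⟩ : ∃ d : ℕ, (i : ℕ) + d + 1 = j := ⟨j - i - 1, by have := Fin.lt_def.mp h; omega⟩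
  induction d generalizing j with
  | zero => exact AddSubmonoid.subset_closure ⟨i, j, by simpa using hd, rfl⟩
  | succ d ih =>
    let k : Fin n := ⟨i + d + 1, by have := j.2; omega⟩
    have h1 := ih k (by rw [Fin.lt_def]; simp only [k]; omega) rfl
    have h2 : (Pi.single k 1 - Pi.single j 1 : Fin n → ℤ) ∈ Psi n :=
      AddSubmonoid.subset_closure ⟨k, j, by simp only [k]; omega, rfl⟩
    have := add_mem h1 h2
    rwa [sub_add_sub_cancel] at this

/-- The degree `v_i - v_j` of `e_{ij}`. -/
def PosRoot.deg {n : ℕ} (p : PosRoot n) : Psi n :=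
  ⟨Pi.single p.1.1 1 - Pi.single p.1.2 1, sub_mem_Psi _ _ p.2⟩

/-- The homogeneous component of degree `γ` of the enveloping algebra: the span of the words in
the `e_{ij}` of total degree `γ`. -/
def EnvAlg.grading (n : ℕ) (γ : Psi n) : Submodule ℂ (EnvAlg n) :=
  Submodule.span ℂ {x | ∃ l : List (PosRoot n), (l.map PosRoot.deg).sum = γ ∧
    x = (l.map EnvAlg.e).prod}

namespace EnvAlg

variable {n : ℕ}

lemma word_mem (l : List (PosRoot n)) :
    (l.map e).prod ∈ grading n (l.map PosRoot.deg).sum :=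
  Submodule.subset_span ⟨l, rfl, rfl⟩

lemma e_mem (p : PosRoot n) : e p ∈ grading n p.deg :=
  Submodule.subset_span ⟨[p], by simp, by simp⟩

instance gradedMonoid : SetLike.GradedMonoid (grading n) where
  one_mem := Submodule.subset_span ⟨[], rfl, rfl⟩
  mul_mem γ δ x y hx hy := by
    have := Submodule.mul_mem_mul hx hy
    rw [grading, grading, Submodule.span_mul_span] at this
    refine Submodule.span_mono ?_ this
    rintro _ ⟨_, ⟨l, rfl, rfl⟩, _, ⟨m, rfl, rfl⟩, rfl⟩
    exact ⟨l ++ m, by simp, by simp⟩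

/-- `e_{ij}` as a homogeneous element of the direct sum of the components. -/
noncomputable def eSum (p : PosRoot n) : ⨁ γ, grading n γ :=
  DirectSum.of (fun γ => grading n γ) p.deg ⟨e p, e_mem p⟩

lemma eq_sum (x : slPlus n) : x = ∑ p : PosRoot n, x.1 p.1.1 p.1.2 • slPlus.e p := by
  apply Subtype.ext
  ext i j
  have h1 : ((∑ p : PosRoot n, x.1 p.1.1 p.1.2 • slPlus.e p : slPlus n) :
      Matrix (Fin n) (Fin n) ℂ) i j =
      ∑ p : PosRoot n, x.1 p.1.1 p.1.2 * Matrix.single p.1.1 p.1.2 (1 : ℂ) i j := by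
    rw [AddSubmonoidClass.coe_finsetSum, Matrix.sum_apply]
    rfl
  rw [h1]
  by_cases h : i < j
  · rw [Finset.sum_eq_single (⟨(i, j), h⟩ : PosRoot n)]
    · simp
    · rintro ⟨⟨k, l⟩, hkl⟩ _ hne
      rw [Matrix.single_apply_of_ne, mul_zero]
      rintro ⟨rfl, rfl⟩
      exact hne rfl
    · simp
  · rw [x.2 i j (not_lt.mp h), Finset.sum_eq_zero]
    rintro ⟨⟨k, l⟩, hkl⟩ _
    rw [Matrix.single_apply_of_ne, mul_zero]
    rintro ⟨rfl, rfl⟩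
    exact h hkl

/-- The linear map `e_{ij} ↦ e_{ij}` from `sl_n^+` to the direct sum of the components. -/
noncomputable def toSumLin (n : ℕ) : slPlus n →ₗ[ℂ] ⨁ γ, grading n γ where
  toFun x := ∑ p : PosRoot n, x.1 p.1.1 p.1.2 • eSum p
  map_add' x y := by simp [add_smul, Finset.sum_add_distrib]
  map_smul' c x := by simp [mul_smul, Finset.smul_sum]

lemma toSumLin_e (p : PosRoot n) : toSumLin n (slPlus.e p) = eSum p := by
  change ∑ q : PosRoot n, Matrix.single p.1.1 p.1.2 (1 : ℂ) q.1.1 q.1.2 • eSum q = _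
  rw [Finset.sum_eq_single p]
  · simp
  · intro q _ hne
    rw [Matrix.single_apply_of_ne, zero_smul]
    rintro ⟨h1, h2⟩
    exact hne (Subtype.ext (Prod.ext h1.symm h2.symm))
  · simp

lemma lie_e (i j k : Fin n) (hij : i < j) (hjk : j < k) :
    ⁅slPlus.e ⟨(i, j), hij⟩, slPlus.e ⟨(j, k), hjk⟩⁆ = slPlus.e ⟨(i, k), hij.trans hjk⟩ := by
  apply Subtype.ext
  rw [LieSubalgebra.coe_bracket, Ring.lie_def]
  simp only [slPlus.e]
  rw [Matrix.single_mul_single_same, Matrix.single_mul_single_of_ne _ _ _ _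
    (hij.trans hjk).ne', sub_zero, one_mul]

lemma lie_e_of_ne (p q : PosRoot n) (h1 : p.1.2 ≠ q.1.1) (h2 : q.1.2 ≠ p.1.1) :
    ⁅slPlus.e p, slPlus.e q⁆ = 0 := by
  apply Subtype.ext
  rw [LieSubalgebra.coe_bracket, Ring.lie_def]
  simp only [slPlus.e]
  rw [Matrix.single_mul_single_of_ne _ _ _ _ h1, Matrix.single_mul_single_of_ne _ _ _ _ h2,
    sub_zero]
  rfl

lemma e_lie (p q : PosRoot n) :
    UniversalEnvelopingAlgebra.ι ℂ ⁅slPlus.e p, slPlus.e q⁆ = e p * e q - e q * e p := by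
  rw [LieHom.map_lie, Ring.lie_def]; rfl

lemma eSum_lie (p q : PosRoot n) : eSum p * eSum q - eSum q * eSum p =
    DirectSum.of (fun γ => grading n γ) (p.deg + q.deg)
      ⟨e p * e q - e q * e p, sub_mem (SetLike.mul_mem_graded (e_mem p) (e_mem q))
        (add_comm q.deg p.deg ▸ SetLike.mul_mem_graded (e_mem q) (e_mem p))⟩ := by
  have h : eSum q * eSum p = DirectSum.of (fun γ => grading n γ) (p.deg + q.deg)
      ⟨e q * e p, add_comm q.deg p.deg ▸ SetLike.mul_mem_graded (e_mem q) (e_mem p)⟩ := by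
    rw [eSum, eSum, DirectSum.of_mul_of]
    exact DirectSum.of_eq_of_gradedMonoid_eq (Sigma.subtype_ext (add_comm _ _) rfl)
  rw [h, eSum, eSum, DirectSum.of_mul_of, ← map_sub]
  rfl

lemma toSumLin_lie_e (p q : PosRoot n) : toSumLin n ⁅slPlus.e p, slPlus.e q⁆ =
    eSum p * eSum q - eSum q * eSum p := by
  have key : ∀ p q : PosRoot n, p.1.2 = q.1.1 → toSumLin n ⁅slPlus.e p, slPlus.e q⁆ =
      eSum p * eSum q - eSum q * eSum p := by
    rintro ⟨⟨i, j⟩, hij⟩ ⟨⟨j', k⟩, hjk⟩ h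
    obtain rfl : j = j' := h
    have hl := e_lie (⟨(i, j), hij⟩ : PosRoot n) ⟨(j, k), hjk⟩
    rw [lie_e i j k hij hjk] at hl ⊢
    rw [toSumLin_e, eSum_lie, eSum]
    refine DirectSum.of_eq_of_gradedMonoid_eq (Sigma.subtype_ext ?_ hl)
    exact Subtype.ext (sub_add_sub_cancel _ _ _).symm
  by_cases h1 : p.1.2 = q.1.1
  · exact key p q h1
  by_cases h2 : q.1.2 = p.1.1
  · rw [← lie_skew, map_neg, key q p h2, neg_sub]
  · have hl := e_lie p q
    rw [lie_e_of_ne p q h1 h2] at hl ⊢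
    rw [eSum_lie, map_zero]
    rw [map_zero] at hl
    symm
    convert map_zero (DirectSum.of (fun γ => grading n γ) (p.deg + q.deg)) using 2
    exact Subtype.ext hl.symm

/-- `toSumLin` as a Lie algebra homomorphism. -/
noncomputable def toSumLie (n : ℕ) : slPlus n →ₗ⁅ℂ⁆ ⨁ γ, grading n γ :=
  { toSumLin n with
    map_lie' := by
      intro x y
      change toSumLin n ⁅x, y⁆ = ⁅toSumLin n x, toSumLin n y⁆
      rw [eq_sum x, eq_sum y]
      have h : ∀ p q : PosRoot n, toSumLin n ⁅slPlus.e p, slPlus.e q⁆ = ⁅eSum p, eSum q⁆ :=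
        fun p q => (toSumLin_lie_e p q).trans (Ring.lie_def _ _).symm
      simp only [sum_lie, lie_sum, smul_lie, lie_smul, map_sum, map_smul, h, toSumLin_e]
      refine Finset.sum_congr rfl fun p _ => ?_
      rw [Finset.smul_sum]
      refine Finset.sum_congr rfl fun q _ => ?_
      simp only [Ring.lie_def, smul_mul_assoc, mul_smul_comm, smul_sub]
      rw [smul_comm (y.1 p.1.1 p.1.2) (x.1 q.1.1 q.1.2) (eSum q * eSum p),
        smul_comm (y.1 p.1.1 p.1.2) (x.1 q.1.1 q.1.2) (eSum p * eSum q)] }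

/-- The decomposition into homogeneous components. -/
noncomputable def toSum (n : ℕ) : EnvAlg n →ₐ[ℂ] ⨁ γ, grading n γ :=
  UniversalEnvelopingAlgebra.lift ℂ (toSumLie n)

lemma toSum_e (p : PosRoot n) : toSum n (e p) = eSum p := by
  rw [toSum, e, UniversalEnvelopingAlgebra.lift_ι_apply]
  exact toSumLin_e p

lemma toSum_word (l : List (PosRoot n)) : toSum n (l.map e).prod =
    DirectSum.of (fun γ => grading n γ) (l.map PosRoot.deg).sum ⟨(l.map e).prod, word_mem l⟩ := by
  induction l with
  | nil => exact map_one _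
  | cons p l ih =>
    simp only [List.map_cons, List.prod_cons]
    rw [map_mul, toSum_e, ih, eSum, DirectSum.of_mul_of]
    rfl

noncomputable instance gradedAlgebra (n : ℕ) : GradedAlgebra (grading n) :=
  GradedAlgebra.ofAlgHom (grading n) (toSum n)
    (by
      refine UniversalEnvelopingAlgebra.hom_ext ℂ ?_
      ext x
      change (DirectSum.coeAlgHom (grading n)) (toSum n (UniversalEnvelopingAlgebra.ι ℂ x)) =
        UniversalEnvelopingAlgebra.ι ℂ x
      rw [eq_sum x]
      simp only [map_sum, map_smul]
      refine Finset.sum_congr rfl fun p _ => ?_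
      congr 1
      refine (congrArg _ (toSum_e p)).trans ?_
      rw [eSum, DirectSum.coeAlgHom_of]
      rfl)
    (by
      rintro γ ⟨x, hx⟩
      change toSum n x = _
      induction hx using Submodule.span_induction with
      | mem x hx =>
        obtain ⟨l, rfl, rfl⟩ := hx
        exact toSum_word l
      | zero => rw [map_zero]; symm; exact map_zero (DirectSum.of (fun γ => grading n γ) γ)
      | add x y hx hy ihx ihy => rw [map_add, ihx, ihy, ← map_add]; rfl
      | smul c x hx ih => rw [map_smul, ih, ← DirectSum.lof_eq_of ℂ, ← map_smul]; rfl)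

end EnvAlg
end LieAlgebra

section Kostant

/-- The divided power `e_{ij}^{(k)} = e_{ij}^k / k!`. -/
noncomputable def EnvAlg.divPow {n : ℕ} (p : PosRoot n) (k : ℕ) : EnvAlg n :=
  ((k.factorial : ℂ)⁻¹) • EnvAlg.e p ^ k

/-- The Kostant form over `ℤ`: the subring of the enveloping algebra generated by all divided
powers of the `e_{ij}`. -/
noncomputable def kostantZ (n : ℕ) : Subalgebra ℤ (EnvAlg n) :=
  Algebra.adjoin ℤ {x | ∃ (p : PosRoot n) (k : ℕ), x = EnvAlg.divPow p k}

/-- The divided power `e_{ij}^{(k)}` as an element of the Kostant form over `ℤ`. -/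
noncomputable def kostantZ.divPow {n : ℕ} (p : PosRoot n) (k : ℕ) : kostantZ n :=
  ⟨EnvAlg.divPow p k, Algebra.subset_adjoin ⟨p, k, rfl⟩⟩

/-- The homogeneous component of degree `γ` of the Kostant form over `ℤ`. -/
noncomputable def kostantZ.grading (n : ℕ) (γ : Psi n) : Submodule ℤ (kostantZ n) :=
  ((EnvAlg.grading n γ).restrictScalars ℤ).comap (kostantZ n).val.toLinearMap

namespace kostantZ

variable {n : ℕ}

lemma mem_grading {γ : Psi n} {x : kostantZ n} :
    x ∈ grading n γ ↔ (x : EnvAlg n) ∈ EnvAlg.grading n γ := Iff.rfl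

lemma divPow_mem (p : PosRoot n) (k : ℕ) : divPow p k ∈ grading n (k • p.deg) :=
  mem_grading.mpr (Submodule.smul_mem _ _ (SetLike.pow_mem_graded k (EnvAlg.e_mem p)))

lemma isHomogeneous (x : EnvAlg n) (hx : x ∈ kostantZ n) (γ : Psi n) :
    ((DirectSum.decompose (EnvAlg.grading n) x γ : EnvAlg.grading n γ) : EnvAlg n) ∈
      kostantZ n := by
  have h : DirectSum.SetLike.IsHomogeneous (EnvAlg.grading n)
      (Subsemiring.closure (Set.range (algebraMap ℤ (EnvAlg n)) ∪
        {x | ∃ (p : PosRoot n) (k : ℕ), x = EnvAlg.divPow p k})) := by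
    refine IsHomogeneous.subsemiringClosure_of_isHomogeneousElem ?_
    rintro _ (⟨z, rfl⟩ | ⟨p, k, rfl⟩)
    · refine ⟨0, ?_⟩
      have h1 : algebraMap ℤ (EnvAlg n) z = algebraMap ℂ (EnvAlg n) z := by simp
      rw [h1]
      exact SetLike.algebraMap_mem_graded (EnvAlg.grading n) _
    · exact ⟨k • p.deg, divPow_mem p k⟩
  exact h γ hx

noncomputable instance gradedAlgebra (n : ℕ) : GradedAlgebra (grading n) where
  one_mem := mem_grading.mpr SetLike.GradedOne.one_mem
  mul_mem _ _ _ _ hx hy := mem_grading.mpr (SetLike.mul_mem_graded hx hy)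
  toDecomposition := by
    refine DirectSum.IsInternal.chooseDecomposition _ ?_
    rw [DirectSum.isInternal_submodule_iff_iSupIndep_and_iSup_eq_top]
    constructor
    · rw [iSupIndep_iff_finsetSum_eq_zero_imp_eq_zero]
      intro s v hv h γ hγ
      have hi := (iSupIndep_iff_finsetSum_eq_zero_imp_eq_zero _).mp
        (DirectSum.Decomposition.isInternal (EnvAlg.grading n)).submodule_iSupIndep
        s (fun γ => (v γ : EnvAlg n)) (fun γ hγ => mem_grading.mp (hv γ hγ))
        (by rw [← AddSubmonoidClass.coe_finsetSum, h]; rfl) γ hγ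
      exact Subtype.ext hi
    · rw [eq_top_iff]
      rintro x -
      classical
      have hx : x = ∑ γ ∈ (DirectSum.decompose (EnvAlg.grading n) (x : EnvAlg n)).support,
          (⟨_, isHomogeneous x.1 x.2 γ⟩ : kostantZ n) := by
        apply Subtype.ext
        rw [AddSubmonoidClass.coe_finsetSum]
        exact (DirectSum.sum_support_decompose (EnvAlg.grading n) (x : EnvAlg n)).symm
      rw [hx]
      exact sum_mem fun γ _ => Submodule.mem_iSup_of_mem γ
        (mem_grading.mpr (DirectSum.decompose (EnvAlg.grading n) (x : EnvAlg n) γ).2)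

end kostantZ
end Kostant

section MainObjects

/-- The Kostant form `𝔄_n(K) = K ⊗_ℤ 𝔄_n(ℤ)`. -/
abbrev KostantAlg (K : Type u) [Field K] (n : ℕ) : Type u := K ⊗[ℤ] kostantZ n

/-- The `Ψ_n`-grading of `𝔄_n(K)`, obtained by extension of scalars. -/
noncomputable abbrev KostantAlg.grading (K : Type u) [Field K] (n : ℕ) (γ : Psi n) :
    Submodule K (KostantAlg K n) :=
  (kostantZ.grading n γ).baseChange K

/-- The divided power `e_{ij}^{(k)}` in `𝔄_n(K)`. -/
noncomputable def KostantAlg.divPow (K : Type u) [Field K] {n : ℕ} (p : PosRoot n) (k : ℕ) :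
    KostantAlg K n :=
  1 ⊗ₜ kostantZ.divPow p k

lemma KostantAlg.divPow_mem (K : Type u) [Field K] {n : ℕ} (p : PosRoot n) (k : ℕ) :
    KostantAlg.divPow K p k ∈ KostantAlg.grading K n (k • p.deg) :=
  Submodule.tmul_mem_baseChange_of_mem _ (kostantZ.divPow_mem p k)

/-- The pairs `(i, j)`, `i < j`, in the order in which `e_{ij}` occur in products from left to
right: `j` decreases, and for equal `j` the index `i` decreases. -/
def PosRoot.list (n : ℕ) : List (PosRoot n) :=
  (List.finRange n).reverse.flatMap fun j =>
    (List.finRange n).reverse.filterMap fun i =>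
      if h : i < j then some ⟨(i, j), h⟩ else none

/-- The ordered product `∏_{i<j} e_{ij}^{(k_{ij})}` in `𝔄_n(K)`. -/
noncomputable def KostantAlg.monomial (K : Type u) [Field K] {n : ℕ}
    (k : Matrix (Fin n) (Fin n) ℕ) : KostantAlg K n :=
  ((PosRoot.list n).map fun p => KostantAlg.divPow K p (k p.1.1 p.1.2)).prod

/-- The action of `Ψ_n` on the algebra `Maps(ℤ^n, K)`: `f ^ γ (z) = f (γ + z)`. -/
def shift (K : Type u) [Field K] (n : ℕ) :
    Multiplicative (Psi n) →* (((Fin n → ℤ) → K) →ₐ[K] ((Fin n → ℤ) → K)) where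
  toFun γ :=
    { toFun := fun f z => f (((Multiplicative.toAdd γ : Psi n) : Fin n → ℤ) + z)
      map_one' := rfl
      map_mul' := fun _ _ => rfl
      map_zero' := rfl
      map_add' := fun _ _ => rfl
      commutes' := fun _ => rfl }
  map_one' := by ext f z; simp
  map_mul' γ δ := by
    ext f z
    change f _ = f (((Multiplicative.toAdd δ : Psi n) : Fin n → ℤ) +
      (((Multiplicative.toAdd γ : Psi n) : Fin n → ℤ) + z))
    rw [toAdd_mul, AddSubmonoid.coe_add, add_assoc, add_left_comm]

/-- The algebra `ℭ_n(K) = 𝔄_n(K) ⋉_{Ψ_n} Maps(ℤ^n, K)`. -/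
abbrev CAlg (K : Type u) [Field K] (n : ℕ) : Type u :=
  SkewProduct (KostantAlg.grading K n) (shift K n)

/-- The set `Λ(n, r)` of compositions of `r` into `n` parts, inside `ℤ^n`. -/
def compositions (n r : ℕ) : Set (Fin n → ℤ) :=
  {z | (∀ i, 0 ≤ z i) ∧ ∑ i, z i = r}

/-- `Dominates y z`: the point `y` of `ℤ^n` dominates `z`. -/
def Dominates {n : ℕ} (y z : Fin n → ℤ) : Prop :=
  ∀ j : Fin n, ∑ i ∈ Finset.Iic j, z i ≤ ∑ i ∈ Finset.Iic j, y i

/-- The set `T(y, z)` of upper triangular matrices over `ℕ` with row sums `y` and column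
sums `z`. -/
def triMatrices {n : ℕ} (y z : Fin n → ℤ) : Set (Matrix (Fin n) (Fin n) ℕ) :=
  {k | (∀ i j, j < i → k i j = 0) ∧
    (∀ i, ∑ j ∈ Finset.Ici i, (k i j : ℤ) = y i) ∧
    (∀ j, ∑ i ∈ Finset.Iic j, (k i j : ℤ) = z j)}

/-- The idempotent `e = 1 ⊗ χ` of `ℭ_n(K)`, where `χ` is the indicator function of `Λ(n, r)`. -/
noncomputable def CAlg.e (K : Type u) [Field K] (n r : ℕ) : CAlg K n :=
  SkewProduct.tmul _ _ 1 ((compositions n r).indicator 1)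

/-- The two-sided ideal `ℭ_n(K) ē ℭ_n(K)`, where `ē = 1 - e`. -/
noncomputable def CAlg.ideal (K : Type u) [Field K] (n r : ℕ) : Ideal (CAlg K n) :=
  (TwoSidedIdeal.span {1 - CAlg.e K n r}).asIdeal

instance (K : Type u) [Field K] (n r : ℕ) : (CAlg.ideal K n r).IsTwoSided :=
  inferInstanceAs ((TwoSidedIdeal.span {1 - CAlg.e K n r}).asIdeal).IsTwoSided

/-- The quotient algebra `ℭ_n(Λ(n, r)) = ℭ_n(K) / ℭ_n(K) ē ℭ_n(K)`. -/
abbrev CLambda (K : Type u) [Field K] (n r : ℕ) : Type u := CAlg K n ⧸ CAlg.ideal K n r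

/-- The triples `(y, z, k)` with `y, z ∈ Λ(n, r)`, `y` dominating `z`, and `k ∈ T(y, z)`. -/
def BasisIndex (n r : ℕ) : Type :=
  {x : (Fin n → ℤ) × (Fin n → ℤ) × Matrix (Fin n) (Fin n) ℕ //
    x.1 ∈ compositions n r ∧ x.2.1 ∈ compositions n r ∧ Dominates x.1 x.2.1 ∧
      x.2.2 ∈ triMatrices x.1 x.2.1}

/-- The class of `∏_{i<j} e_{ij}^{(k_{ij})} χ_z` in `ℭ_n(Λ(n, r))`, for a triple `(y, z, k)`. -/
noncomputable def CLambda.basisElement (K : Type u) [Field K] {n r : ℕ} (x : BasisIndex n r) :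
    CLambda K n r :=
  Ideal.Quotient.mk (CAlg.ideal K n r)
    (SkewProduct.tmul _ _ (KostantAlg.monomial K x.1.2.2) (Pi.single x.1.2.1 1))

end MainObjects

/-! Write C for `CAlg K n`, A for `KostantAlg K n`, I for `CAlg.ideal K n r`. Call a C-module
orthogonal if all its Ext groups, Hom included, into modules killed by I vanish. Since C is
projective, orthogonality of the left module I gives Ext^i(C/I, Y) = 0 for i ≥ 1 and Y killed by I.
Dimension shifting along free C/I-modules turns this into strong idempotence
(`isStrongIdempotentIdeal_of_extOrthogonal`).

Everything rests on the PBW basis of A. It spans by the straightening formula for divided powers,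
and it is independent because ordered products applied to 1 in a polynomial representation give
distinct monomials, up to nonzero scalars. Columns decrease from left to right in an ordered
product, so A is free as a right module over the subalgebra of columns ≤ m. In that subalgebra the
m-th coordinate of the degree is minus the sum of column m. Hence the ordered products whose column
m has sum > d span a left ideal (`isLeftClosed_colSum`).

For μ in Λ(n, r) call an exponent bad if some column sum exceeds the corresponding μ_j. A bad
product times χ_μ lies in I, because its low part reaches a weight with a negative coordinate; any
other product sends μ into Λ(n, r). So I consists of the elements whose value at each such μ lies in
the bad span (`mem_ideal_iff`). The remaining products give the basis of C/I, the diagonal of the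
matrix being the slack μ_j minus the column sum.

It also follows that I is the direct sum of C(1 - e) and of the left ideals of bad multiples of χ_μ.
The first is generated by an idempotent of I, hence orthogonal. The others are built one column at a
time by Mayer–Vietoris, which leaves modules induced from columns ≤ m with weights negative at m
(`IsInduced`). Such a module is a quotient of a sum of projectives Cχ_ν with ν_m < 0; these have no
maps to modules killed by I and are induced in the same way, and freeness makes the kernel induced
again. Iterating gives a resolution that proves orthogonality. -/

section ExtLemmas
-- Vanishing of Ext in abelian categories.
open Limits Abelian

/-- Dimension shifting in the second variable along an embedding into an injective. In degree one
the claim is that a map to the cokernel lifts, and lifts can be glued from the summands; no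
exactness of coproducts is needed. -/
lemma ext_eq_zero_of_isColimit_cofan {C : Type*} [Category C] [Abelian C] [EnoughInjectives C]
    [HasExt.{w} C] {ι : Type*} {N : C} {F : ι → C} (i : ∀ k, F k ⟶ N)
    (hN : IsColimit (Cofan.mk N i)) (n : ℕ) (Y : C)
    (h : ∀ k (x : Ext.{w} (F k) Y (n + 1)), x = 0) (x : Ext.{w} N Y (n + 1)) : x = 0 := by
  induction n generalizing Y with
  | zero =>
    let S := ShortComplex.mk _ _ (cokernel.condition (Injective.ι Y))
    have hS : S.ShortExact := { exact := ShortComplex.exact_cokernel _ }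
    obtain ⟨y, rfl⟩ := Ext.covariant_sequence_exact₁ N hS x (Ext.eq_zero_of_injective _) rfl
    obtain ⟨φ, rfl⟩ := (Ext.mk₀_bijective _ _).2 y
    -- The obstruction to lifting the restriction of `φ` to a summand lies in Ext¹(F k, Y), which
    -- vanishes.
    have hψ : ∀ k, ∃ ψ : F k ⟶ S.X₂, ψ ≫ S.g = i k ≫ φ := by
      intro k
      obtain ⟨z, hz⟩ := Ext.covariant_sequence_exact₃ (F k) hS (Ext.mk₀ (i k ≫ φ)) rfl (h k _)
      obtain ⟨ψ, rfl⟩ := (Ext.mk₀_bijective _ _).2 z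
      refine ⟨ψ, (Ext.mk₀_bijective _ _).1 ?_⟩
      rw [← hz, Ext.mk₀_comp_mk₀]
    choose ψ hψ using hψ
    have hφ : φ = Cofan.IsColimit.desc hN ψ ≫ S.g := by
      refine Cofan.IsColimit.hom_ext hN _ _ fun k => ?_
      have h1 : (Cofan.mk N i).inj k = i k := rfl
      have h2 := Cofan.IsColimit.fac hN ψ k
      rw [← Category.assoc, h2, hψ, h1]
    rw [hφ, ← Ext.mk₀_comp_mk₀, Ext.comp_assoc_of_second_deg_zero, hS.comp_extClass, Ext.comp_zero]
  | succ n ih =>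
    let S := ShortComplex.mk _ _ (cokernel.condition (Injective.ι Y))
    have hS : S.ShortExact := { exact := ShortComplex.exact_cokernel _ }
    obtain ⟨y, rfl⟩ := Ext.covariant_sequence_exact₁ N hS x (Ext.eq_zero_of_injective _) rfl
    rw [ih S.X₃ (fun k z => ?_) y, Ext.zero_comp]
    obtain ⟨t, rfl⟩ := Ext.covariant_sequence_exact₃ (F k) hS z rfl (h k _)
    have : Injective S.X₂ := inferInstanceAs (Injective (Injective.under Y))
    rw [Ext.eq_zero_of_injective t, Ext.zero_comp]

/-- The object `N` has no nonzero extensions, in any degree `≥ 0`, by objects satisfying `Q`. -/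
def ExtOrthogonal {C : Type*} [Category C] [Abelian C] [HasExt.{w} C] (Q : ObjectProperty C)
    (N : C) : Prop :=
  ∀ (Y : C), Q Y → ∀ (n : ℕ) (x : Ext.{w} N Y n), x = 0

namespace ExtOrthogonal

variable {C : Type*} [Category C] [Abelian C] [HasExt.{w} C] {Q : ObjectProperty C}

/-- Iterating the hypothesis yields a projective resolution none of whose terms maps nontrivially to
an object of `Q`. Each shift to the syzygy lowers the degree by one, until a Hom out of a quotient
of such a projective is left. -/
lemma of_syzygy (T : ObjectProperty C)
    (hT : ∀ N, T N → ∃ S : ShortComplex C, S.ShortExact ∧ S.X₃ = N ∧ Projective S.X₂ ∧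
      (∀ Y, Q Y → ∀ f : S.X₂ ⟶ Y, f = 0) ∧ T S.X₁) {N : C} (hN : T N) : ExtOrthogonal.{w} Q N := by
  intro Y hY n
  induction n generalizing N with
  | zero =>
    intro x
    obtain ⟨S, hS, rfl, hP, h0, h1⟩ := hT N hN
    obtain ⟨φ, rfl⟩ := (Ext.mk₀_bijective _ _).2 x
    have := hS.epi_g
    rw [show φ = 0 from (cancel_epi S.g).1 (by rw [h0 Y hY (S.g ≫ φ), comp_zero]), Ext.mk₀_zero]
  | succ n ih =>
    intro x
    obtain ⟨S, hS, rfl, hP, h0, h1⟩ := hT N hN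
    obtain ⟨y, rfl⟩ := Ext.contravariant_sequence_exact₃ hS Y x (Ext.eq_zero_of_projective _)
      (add_comm 1 n)
    rw [ih h1 y, Ext.comp_zero]

variable {S : ShortComplex C} (hS : S.ShortExact)
include hS

lemma X₂ (h1 : ExtOrthogonal.{w} Q S.X₁) (h3 : ExtOrthogonal.{w} Q S.X₃) :
    ExtOrthogonal.{w} Q S.X₂ := by
  intro Y hY n x
  obtain ⟨y, rfl⟩ := Ext.contravariant_sequence_exact₂ hS Y x (h1 Y hY n _)
  rw [h3 Y hY n y, Ext.comp_zero]

lemma X₃ (h1 : ExtOrthogonal.{w} Q S.X₁) (h2 : ExtOrthogonal.{w} Q S.X₂) :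
    ExtOrthogonal.{w} Q S.X₃ := by
  intro Y hY n x
  cases n with
  | zero =>
    obtain ⟨φ, rfl⟩ := (Ext.mk₀_bijective _ _).2 x
    have := hS.epi_g
    have h := h2 Y hY 0 (Ext.mk₀ (S.g ≫ φ))
    rw [show φ = 0 from (cancel_epi S.g).1 ((Ext.mk₀_bijective _ _).1
      (by rw [h, comp_zero, Ext.mk₀_zero])), Ext.mk₀_zero]
  | succ n =>
    obtain ⟨y, rfl⟩ := Ext.contravariant_sequence_exact₃ hS Y x (h2 Y hY _ _) (add_comm 1 n)
    rw [h1 Y hY n y, Ext.comp_zero]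

omit hS in
lemma of_iso {M N : C} (e : M ≅ N) (h : ExtOrthogonal.{w} Q M) : ExtOrthogonal.{w} Q N := by
  intro Y hY n x
  have : x = (Ext.mk₀ e.inv).comp ((Ext.mk₀ e.hom).comp x (zero_add n)) (zero_add n) := by
    simp
  rw [this, h Y hY n ((Ext.mk₀ e.hom).comp x (zero_add n)), Ext.comp_zero]

/-- A quotient of a projective object by an orthogonal subobject has no higher extensions. -/
lemma ext_succ_eq_zero [Projective S.X₂] (h1 : ExtOrthogonal.{w} Q S.X₁) {Y : C} (hY : Q Y) (n : ℕ)
    (x : Ext.{w} S.X₃ Y (n + 1)) : x = 0 := by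
  obtain ⟨y, rfl⟩ := Ext.contravariant_sequence_exact₃ hS Y x (Ext.eq_zero_of_projective _)
    (add_comm 1 n)
  rw [h1 Y hY n y, Ext.comp_zero]

end ExtOrthogonal

end ExtLemmas

/-! ### Ext groups along a surjective ring homomorphism. -/

section RestrictScalarsExt
open Limits Abelian

variable {R S : Type u} [Ring R] [Ring S] (f : R →+* S)

lemma restrictScalars_full_of_surjective (hf : Function.Surjective f) :
    (ModuleCat.restrictScalars.{u} f).Full where
  map_surjective {X Y} g := by
    refine ⟨ModuleCat.ofHom (X := X) (Y := Y)
      { toFun := g.hom, map_add' := g.hom.map_add, map_smul' := fun s x => ?_ }, rfl⟩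
    obtain ⟨r, rfl⟩ := hf s
    exact g.hom.map_smul r x

/-- Restriction of scalars is left adjoint to coextension, so it preserves the coproduct of copies
of `S`. -/
lemma restrictScalars_ext_finsupp_eq_zero (Y : ModuleCat.{u} R) (n : ℕ) (X : Type u)
    (h : ∀ x : Ext.{u} ((ModuleCat.restrictScalars.{u} f).obj (ModuleCat.of S S)) Y (n + 1), x = 0)
    (x : Ext.{u} ((ModuleCat.restrictScalars.{u} f).obj (ModuleCat.of S (X →₀ S))) Y (n + 1)) :
    x = 0 := by
  refine ext_eq_zero_of_isColimit_cofan
    (F := fun _ : X => (ModuleCat.restrictScalars.{u} f).obj (ModuleCat.of S S))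
    (fun k => (ModuleCat.restrictScalars.{u} f).map (ModuleCat.ofHom (Finsupp.lsingle k))) ?_ n Y
    (fun _ => h) x
  have h1 : IsColimit (Cofan.mk (ModuleCat.of S (X →₀ S))
      fun k : X => ModuleCat.ofHom (X := S) (Finsupp.lsingle k)) := by
    refine Cofan.IsColimit.mk _ (fun t => ModuleCat.ofHom (Finsupp.lsum ℕ fun k => (t.inj k).hom))
      (fun t k => ?_) (fun t m hm => ?_)
    · ext
      simp [Cofan.inj]
    · refine ModuleCat.hom_ext (Finsupp.lhom_ext' fun k => LinearMap.ext_ring ?_)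
      have := congr($(hm k).hom (1 : S))
      simpa [Cofan.inj] using this
  have : PreservesColimitsOfSize.{0, u} (ModuleCat.restrictScalars.{u} f) :=
    (ModuleCat.restrictCoextendScalarsAdj.{u, u, u} f).leftAdjoint_preservesColimits
  exact isColimitCofanMkObjOfIsColimit _ _ _ h1

/-- Dimension shifting along a free cover of `X`. Higher Ext out of the cover vanishes over `S` by
projectivity and over `R` by hypothesis, so on both sides Ext in degree n + 1 is a cokernel of
groups in degree n. Degree 0 is full faithfulness. -/
lemma restrictScalars_mapExt_bijective (hf : Function.Surjective f)
    (h : ∀ (Y : ModuleCat.{u} S) (n : ℕ)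
      (x : Ext.{u} ((ModuleCat.restrictScalars.{u} f).obj (ModuleCat.of S S))
        ((ModuleCat.restrictScalars.{u} f).obj Y) (n + 1)), x = 0)
    (X Y : ModuleCat.{u} S) (n : ℕ) :
    Function.Bijective ((ModuleCat.restrictScalars.{u} f).mapExtAddHom X Y n) := by
  have := restrictScalars_full_of_surjective f hf
  set F := ModuleCat.restrictScalars.{u} f with hF
  induction n generalizing X with
  | zero => simpa [Ext.mapExactFunctor₀] using ⟨F.map_injective, F.map_surjective⟩
  | succ n hn =>
    let p : (X →₀ S) →ₗ[S] X := Finsupp.lsum ℕ fun x => LinearMap.toSpanSingleton S X x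
    let T := p.shortComplexKer
    have hT : T.ShortExact := LinearMap.shortExact_shortComplexKer fun x =>
      ⟨Finsupp.single x 1, by simp [p]⟩
    have : Projective T.X₂ := ModuleCat.projective_of_free (R := S) Finsupp.basisSingleOne
    exact AddMonoidHom.bijective_of_surjective_of_bijective_of_right_exact _ _ _ _
      (F.mapExtAddHom T.X₂ Y n) (F.mapExtAddHom T.X₁ Y n) (F.mapExtAddHom T.X₃ Y (n + 1))
      (by ext; simp [Ext.mapExactFunctor_comp, Ext.mapExactFunctor_mk₀]; rfl)
      (by ext; simp [Ext.mapExactFunctor_comp, Ext.mapExactFunctor_extClass]; rfl)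
      ((ShortComplex.ab_exact_iff_function_exact _).1
        (Ext.contravariant_sequence_exact₁' hT Y n (n + 1) (add_comm 1 n)))
      ((ShortComplex.ab_exact_iff_function_exact _).1
        (Ext.contravariant_sequence_exact₁' (hT.map_of_exact F) (F.obj Y) n (n + 1) (add_comm 1 n)))
      (hn _).surjective (hn _)
      (fun x₃ ↦ Ext.contravariant_sequence_exact₃ hT _ x₃ (Ext.eq_zero_of_projective _)
        (add_comm 1 n))
      (fun y₃ ↦ Ext.contravariant_sequence_exact₃ (hT.map_of_exact F) _ y₃
        (restrictScalars_ext_finsupp_eq_zero f _ n X (h Y n) _) (add_comm 1 n))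

end RestrictScalarsExt

/-! ### Orthogonal submodules and a criterion for strong idempotence. -/

section ModuleOrthogonal
open Abelian

variable {R : Type u} [Ring R] {Q : ObjectProperty (ModuleCat.{u} R)}
variable {M : Type u} [AddCommGroup M] [Module R M]

namespace ExtOrthogonal

lemma congr {N N' : Type u} [AddCommGroup N] [Module R N] [AddCommGroup N'] [Module R N']
    (e : N ≃ₗ[R] N') (h : ExtOrthogonal.{u} Q (ModuleCat.of R N)) :
    ExtOrthogonal.{u} Q (ModuleCat.of R N') :=
  h.of_iso e.toModuleIso

lemma shortExact_quotient (N : Submodule R M) :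
    (ModuleCat.shortComplexOfCompEqZero N.subtype N.mkQ (by ext; simp)).ShortExact :=
  ModuleCat.shortComplex_shortExact _ (LinearMap.exact_subtype_mkQ N) N.injective_subtype
    N.mkQ_surjective

lemma bot : ExtOrthogonal.{u} Q (ModuleCat.of R (⊥ : Submodule R M)) := by
  intro Y _ n x
  have h : (𝟙 (ModuleCat.of R (⊥ : Submodule R M))) = 0 := by
    ext x
  rw [← Ext.mk₀_id_comp x, h, Ext.mk₀_zero, Ext.zero_comp]

/-- Mayer–Vietoris: N / (N ⊓ P) is orthogonal by `X₃` and isomorphic to (N ⊔ P) / P, so `X₂` applies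
to the extension of it by P. -/
lemma sup {N P : Submodule R M} (hN : ExtOrthogonal.{u} Q (ModuleCat.of R N))
    (hP : ExtOrthogonal.{u} Q (ModuleCat.of R P))
    (hNP : ExtOrthogonal.{u} Q (ModuleCat.of R (N ⊓ P : Submodule R M))) :
    ExtOrthogonal.{u} Q (ModuleCat.of R (N ⊔ P : Submodule R M)) := by
  have h1 : ExtOrthogonal.{u} Q (ModuleCat.of R
      (Submodule.comap N.subtype N ⊓ Submodule.comap N.subtype P : Submodule R N)) :=
    congr (Submodule.comapSubtypeEquivOfLe inf_le_left).symm hNP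
  have h2 := X₃ (shortExact_quotient _) h1 hN
  have h3 : ExtOrthogonal.{u} Q (ModuleCat.of R (Submodule.comap (N ⊔ P).subtype P)) :=
    congr (Submodule.comapSubtypeEquivOfLe le_sup_right).symm hP
  exact X₂ (shortExact_quotient _) h3 (congr (LinearMap.quotientInfEquivSupQuotient N P) h2)

end ExtOrthogonal

/-- The property of being killed by the ideal `I`. -/
def KilledBy (I : Ideal R) : ObjectProperty (ModuleCat.{u} R) :=
  fun Y => ∀ a ∈ I, ∀ y : Y, a • y = 0

/-- In 0 → I → R → R/I → 0 the middle term is projective, so the orthogonality of I kills the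
positive Ext groups of R/I. -/
lemma isStrongIdempotentIdeal_of_extOrthogonal (I : Ideal R) [I.IsTwoSided]
    (h : ExtOrthogonal.{u} (KilledBy I) (ModuleCat.of R I)) : IsStrongIdempotentIdeal I := by
  intro k X Y i _ _
  refine restrictScalars_mapExt_bijective _ Ideal.Quotient.mk_surjective (fun Y n x => ?_) X Y i
  have hS : (ModuleCat.shortComplexOfCompEqZero (M := I) (N := R)
      (L := (ModuleCat.restrictScalars.{u} (Ideal.Quotient.mk I)).obj (ModuleCat.of (R ⧸ I) (R ⧸ I)))
      (Submodule.subtype I) (Submodule.mkQ I)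
      (LinearMap.ext fun x => (Submodule.Quotient.mk_eq_zero I).mpr x.2)).ShortExact :=
    ExtOrthogonal.shortExact_quotient I
  have : Projective (ModuleCat.of R R) :=
    ModuleCat.projective_of_free (R := R) (Module.Basis.singleton Unit R)
  refine ExtOrthogonal.ext_succ_eq_zero hS h ?_ n x
  intro a ha y
  change (Ideal.Quotient.mk I a) • (show Y from y) = 0
  rw [Ideal.Quotient.eq_zero_iff_mem.mpr ha, zero_smul]

end ModuleOrthogonal

/-! ### Straightening of divided powers. -/

section DividedPowers

variable {𝕜 A : Type*} [Field 𝕜] [Ring A] [Algebra 𝕜 A]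

variable (𝕜) in
/-- The divided power `x ^ k / k!`. -/
def dividedPow (x : A) (k : ℕ) : A := ((k.factorial : 𝕜)⁻¹) • x ^ k

lemma dividedPow_zero (x : A) : dividedPow 𝕜 x 0 = 1 := by simp [dividedPow]

lemma Commute.dividedPow_dividedPow {x y : A} (h : Commute x y) (k l : ℕ) :
    Commute (dividedPow 𝕜 x k) (dividedPow 𝕜 y l) :=
  ((h.pow_pow k l).smul_left _).smul_right _

variable [CharZero 𝕜]

lemma mul_dividedPow (x : A) (k : ℕ) :
    x * dividedPow 𝕜 x k = (k + 1 : 𝕜) • dividedPow 𝕜 x (k + 1) := by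
  have h : (k.factorial : 𝕜) ≠ 0 := Nat.cast_ne_zero.mpr k.factorial_ne_zero
  have h' : (k + 1 : 𝕜) ≠ 0 := Nat.cast_add_one_ne_zero k
  rw [dividedPow, dividedPow, mul_smul_comm, smul_smul, ← pow_succ', Nat.factorial_succ]
  congr 1
  push_cast
  field_simp

lemma dividedPow_mul_dividedPow (x : A) (k l : ℕ) :
    dividedPow 𝕜 x k * dividedPow 𝕜 x l = ((k + l).choose k) • dividedPow 𝕜 x (k + l) := by
  have h : (k.factorial : 𝕜) ≠ 0 := Nat.cast_ne_zero.mpr k.factorial_ne_zero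
  have h' : (l.factorial : 𝕜) ≠ 0 := Nat.cast_ne_zero.mpr l.factorial_ne_zero
  have h'' : ((k + l).factorial : 𝕜) ≠ 0 := Nat.cast_ne_zero.mpr (k + l).factorial_ne_zero
  rw [← Nat.cast_smul_eq_nsmul 𝕜, Nat.cast_add_choose]
  simp only [dividedPow, smul_mul_smul_comm, smul_smul, pow_add]
  congr 1
  field_simp

/-- The commutator with `x` acts as a derivation, so it takes `y ^ (k + 1)` to `(k + 1) y ^ k z`;
the factor `k + 1` cancels against the factorial. -/
lemma mul_dividedPow_of_lie {x y z : A} (hxy : x * y = y * x + z) (hyz : Commute y z) (k : ℕ) :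
    x * dividedPow 𝕜 y (k + 1) = dividedPow 𝕜 y (k + 1) * x + dividedPow 𝕜 y k * z := by
  have key : ∀ k : ℕ, x * y ^ (k + 1) = y ^ (k + 1) * x + (k + 1 : 𝕜) • (y ^ k * z) := by
    intro k
    induction k with
    | zero => simp [hxy]
    | succ k ih =>
      rw [pow_succ y (k + 1), ← mul_assoc, ih, add_mul, mul_assoc, hxy, mul_add, smul_mul_assoc,
        mul_assoc (y ^ k), ← hyz.eq, ← mul_assoc (y ^ k), ← pow_succ, ← mul_assoc]
      push_cast
      module
  have h' : (k + 1 : 𝕜) ≠ 0 := Nat.cast_add_one_ne_zero k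
  have h : (k.factorial : 𝕜) ≠ 0 := Nat.cast_ne_zero.mpr k.factorial_ne_zero
  simp only [dividedPow, mul_smul_comm, smul_mul_assoc]
  rw [key, smul_add, smul_smul, Nat.factorial_succ]
  congr 2
  push_cast
  field_simp

/-- The straightening formula for divided powers in a Heisenberg algebra. -/
lemma dividedPow_mul_dividedPow_of_lie {x y z : A} (hxy : x * y = y * x + z) (hxz : Commute x z)
    (hyz : Commute y z) (a b : ℕ) :
    dividedPow 𝕜 x a * dividedPow 𝕜 y b = ∑ s ∈ Finset.range (a + 1),
      (if s ≤ b then dividedPow 𝕜 y (b - s) else 0) * dividedPow 𝕜 z s *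
        dividedPow 𝕜 x (a - s) := by
  -- Divided powers of negative exponent count as 0, so one commutation rule holds for all `s`,
  -- including the boundary `s = b`.
  have hy : ∀ s, x * (if s ≤ b then dividedPow 𝕜 y (b - s) else 0) =
      (if s ≤ b then dividedPow 𝕜 y (b - s) else 0) * x +
        (if s + 1 ≤ b then dividedPow 𝕜 y (b - (s + 1)) else 0) * z := by
    intro s
    rcases lt_trichotomy s b with h | rfl | h
    · obtain ⟨d, rfl⟩ := Nat.exists_eq_add_of_lt h
      rw [if_pos (by omega), if_pos (by omega), show s + d + 1 - s = d + 1 by omega,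
        show s + d + 1 - (s + 1) = d by omega, mul_dividedPow_of_lie hxy hyz]
    · simp [dividedPow_zero]
    · rw [if_neg (by omega), if_neg (by omega)]; simp
  induction a with
  | zero => simp [dividedPow_zero]
  | succ a ih =>
    have ha : (a + 1 : 𝕜) ≠ 0 := Nat.cast_add_one_ne_zero a
    -- `(a + 1)` times the divided power of order `a + 1` is `x` times that of order `a`, so both
    -- sides are compared after scaling by `a + 1`.
    refine smul_right_injective A ha ?_
    simp only
    rw [← smul_mul_assoc, ← mul_dividedPow, mul_assoc, ih, Finset.mul_sum]
    set Y : ℕ → A := fun s => if s ≤ b then dividedPow 𝕜 y (b - s) else 0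
    set t : ℕ → A := fun s => Y s * dividedPow 𝕜 z s * dividedPow 𝕜 x (a + 1 - s) with ht
    -- Moving `x` to the right contributes a factor `a + 1 - s` from the power of `x` and `s + 1`
    -- from the power of `z`. After an index shift the coefficients of `t s` add up to `(a + 1 - s)
    -- + s`.
    have h1 : ∀ s ∈ Finset.range (a + 1), x * (Y s * dividedPow 𝕜 z s * dividedPow 𝕜 x (a - s)) =
        ((a + 1 : 𝕜) - s) • t s + ((s + 1 : ℕ) : 𝕜) • t (s + 1) := by
      intro s hs
      have hs : s ≤ a := Nat.lt_succ_iff.mp (Finset.mem_range.mp hs)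
      have hcz : x * dividedPow 𝕜 z s = dividedPow 𝕜 z s * x := (hxz.pow_right s).smul_right _
      obtain ⟨d, rfl⟩ := Nat.exists_eq_add_of_le hs
      rw [ht]
      simp only
      rw [show s + d - s = d by omega, show s + d + 1 - s = d + 1 by omega,
        show s + d + 1 - (s + 1) = d by omega, ← mul_assoc, ← mul_assoc, hy s, add_mul, add_mul,
        mul_assoc (Y s) x, hcz, mul_assoc (Y s), mul_assoc _ x, mul_dividedPow,
        mul_assoc (Y (s + 1)) z, mul_dividedPow]
      simp only [mul_smul_comm, smul_mul_assoc, mul_assoc]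
      congr 2
      · push_cast; ring
      · push_cast; ring
    rw [Finset.sum_congr rfl h1, Finset.sum_add_distrib]
    have h2 : ∑ s ∈ Finset.range (a + 1), ((a + 1 : 𝕜) - s) • t s =
        ∑ s ∈ Finset.range (a + 1 + 1), ((a + 1 : 𝕜) - s) • t s := by
      rw [Finset.sum_range_succ _ (a + 1)]; simp
    have h3 : ∑ s ∈ Finset.range (a + 1), ((s + 1 : ℕ) : 𝕜) • t (s + 1) =
        ∑ s ∈ Finset.range (a + 1 + 1), (s : 𝕜) • t s := by
      rw [Finset.sum_range_succ' _ (a + 1)]; simp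
    rw [h2, h3, ← Finset.sum_add_distrib, Finset.smul_sum]
    refine Finset.sum_congr rfl fun s _ => ?_
    rw [← add_smul]
    congr 1
    ring

end DividedPowers

/-! ### The order on positive roots. -/

namespace PosRoot

variable {n : ℕ}

/-- `q.Before p`: the factor `e_q` stands to the left of `e_p` in ordered products. -/
def Before (q p : PosRoot n) : Prop := p.1.2 < q.1.2 ∨ p.1.2 = q.1.2 ∧ p.1.1 < q.1.1

lemma pairwise_list (n : ℕ) : (PosRoot.list n).Pairwise Before := by
  rw [PosRoot.list, List.pairwise_flatMap]
  constructor
  · intro j _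
    rw [List.pairwise_filterMap, List.pairwise_reverse]
    refine (List.pairwise_lt_finRange n).imp ?_
    intro a b hab p hp q hq
    split_ifs at hp hq
    simp only [Option.some.injEq] at hp hq
    subst hp hq
    exact Or.inr ⟨rfl, hab⟩
  · rw [List.pairwise_reverse]
    refine (List.pairwise_lt_finRange n).imp ?_
    intro a b hab p hp q hq
    rw [List.mem_filterMap] at hp hq
    obtain ⟨i, _, hi⟩ := hp
    obtain ⟨i', _, hi'⟩ := hq
    split_ifs at hi hi'
    simp only [Option.some.injEq] at hi hi'
    subst hi hi'
    exact Or.inl hab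

lemma mem_list (p : PosRoot n) : p ∈ PosRoot.list n := by
  rw [PosRoot.list, List.mem_flatMap]
  refine ⟨p.1.2, by simp, ?_⟩
  rw [List.mem_filterMap]
  exact ⟨p.1.1, by simp, by rw [dif_pos p.2]⟩

lemma Before.ne {q p : PosRoot n} (h : q.Before p) : q ≠ p := by
  rintro rfl
  rcases h with h | h
  · exact lt_irrefl _ h
  · exact lt_irrefl _ h.2

lemma nodup_list (n : ℕ) : (PosRoot.list n).Nodup := (pairwise_list n).imp Before.ne

/-- The positive root `(i, k)` for `p = (i, j)` and `q = (j, k)`. -/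
def add (p q : PosRoot n) (h : p.1.2 = q.1.1) : PosRoot n :=
  ⟨(p.1.1, q.1.2), p.2.trans (h ▸ q.2)⟩

end PosRoot

/-! ### Closure of ordered products under multiplication. -/

section OrderedProducts

variable {𝕜 A : Type*} [CommRing 𝕜] [Ring A] [Algebra 𝕜 A] {n : ℕ}

/-- A family of submodules satisfying the commutation relations of divided powers of root
vectors. -/
structure IsRootFamily (E : PosRoot n → Submodule 𝕜 A) : Prop where
  one_le (p) : 1 ≤ E p
  mul_self_le (p) : E p * E p ≤ E p
  comm_le (p q) (h : p.1.2 ≠ q.1.1) (h' : q.1.2 ≠ p.1.1) : E p * E q ≤ E q * E p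
  add_le (p q) (h : p.1.2 = q.1.1) : E p * E q ≤ E q * E (p.add q h) * E p

namespace IsRootFamily

variable {E : PosRoot n → Submodule 𝕜 A} (hE : IsRootFamily E)
include hE

/-- The new factor moves right until it meets its own root. Crossing `q` creates at most a factor at
the root sum, which has the column of `q` and a smaller row, so it belongs to the tail and is
absorbed there too. -/
lemma mul_prod_le {l : List (PosRoot n)} (hl : l.Pairwise PosRoot.Before)
    (hadd : ∀ p ∈ l, ∀ q ∈ l, ∀ h : p.1.2 = q.1.1, p.add q h ∈ l) :
    ∀ p ∈ l, E p * (l.map E).prod ≤ (l.map E).prod := by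
  induction l with
  | nil => simp
  | cons q l ih =>
    rw [List.pairwise_cons] at hl
    obtain ⟨hq, hl⟩ := hl
    -- A sum `p + r` of tail roots is not the head: it would share the column of `r` with a smaller
    -- row, while the head in that column has a larger row.
    specialize ih hl (fun p hp r hr h => by
      have h1 := hadd p (List.mem_cons_of_mem _ hp) r (List.mem_cons_of_mem _ hr) h
      rcases List.mem_cons.mp h1 with h2 | h2
      · exfalso
        have h3 := hq r hr
        rw [← h2] at h3
        rcases h3 with h3 | h3
        · exact lt_irrefl _ h3
        · exact absurd (h3.2.trans p.2) (h ▸ lt_irrefl _)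
      · exact h2)
    intro p hp
    rw [List.map_cons, List.prod_cons]
    rcases List.mem_cons.mp hp with rfl | hp'
    · rw [← mul_assoc]
      exact mul_le_mul_left (hE.mul_self_le _) _
    · have hne : q.1.2 ≠ p.1.1 := by
        rcases hq p hp' with h | h
        · exact (p.2.trans h).ne'
        · exact (p.2.trans_eq h.1).ne'
      by_cases h : p.1.2 = q.1.1
      · have h1 := hadd p hp q (List.mem_cons_self ..) h
        have h2 : p.add q h ∈ l := by
          rcases List.mem_cons.mp h1 with h2 | h2
          · have : p.1.1 = q.1.1 := congrArg (fun r => r.1.1) h2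
            exact absurd p.2 (by rw [h, this]; exact lt_irrefl _)
          · exact h2
        calc E p * (E q * (l.map E).prod) = E p * E q * (l.map E).prod := (mul_assoc ..).symm
          _ ≤ E q * E (p.add q h) * E p * (l.map E).prod := mul_le_mul_left (hE.add_le p q h) _
          _ = E q * (E (p.add q h) * (E p * (l.map E).prod)) := by simp only [mul_assoc]
          _ ≤ E q * (E (p.add q h) * (l.map E).prod) := by gcongr; exact ih p hp'
          _ ≤ E q * (l.map E).prod := by gcongr; exact ih _ h2
      · calc E p * (E q * (l.map E).prod) = E p * E q * (l.map E).prod := (mul_assoc ..).symm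
          _ ≤ E q * E p * (l.map E).prod := mul_le_mul_left (hE.comm_le p q h hne) _
          _ = E q * (E p * (l.map E).prod) := mul_assoc ..
          _ ≤ E q * (l.map E).prod := by gcongr; exact ih p hp'

lemma prod_mul_prod_le {l : List (PosRoot n)} (hl : l.Pairwise PosRoot.Before)
    (hadd : ∀ p ∈ l, ∀ q ∈ l, ∀ h : p.1.2 = q.1.1, p.add q h ∈ l) :
    (l.map E).prod * (l.map E).prod ≤ (l.map E).prod := by
  suffices ∀ l' : List (PosRoot n), (∀ p ∈ l', p ∈ l) →
      (l'.map E).prod * (l.map E).prod ≤ (l.map E).prod from this l fun _ => id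
  intro l'
  induction l' with
  | nil => simp
  | cons q l' ih =>
    intro h
    rw [List.map_cons, List.prod_cons, mul_assoc]
    refine le_trans ?_ (hE.mul_prod_le hl hadd q (h q (List.mem_cons_self ..)))
    gcongr
    exact ih fun p hp => h p (List.mem_cons_of_mem _ hp)

lemma one_le_prod (l : List (PosRoot n)) : 1 ≤ (l.map E).prod := by
  induction l with
  | nil => simp
  | cons q l ih =>
    rw [List.map_cons, List.prod_cons]
    calc (1 : Submodule 𝕜 A) = 1 * 1 := (one_mul _).symm
      _ ≤ _ := mul_le_mul' (hE.one_le q) ih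

omit hE in
lemma prod_map_span_range (g : PosRoot n → ℕ → A) {l : List (PosRoot n)} (hl : l.Nodup) :
    (l.map fun p => Submodule.span 𝕜 (Set.range (g p))).prod =
      Submodule.span 𝕜 (Set.range fun k : PosRoot n → ℕ => (l.map fun p => g p (k p)).prod) := by
  induction l with
  | nil => simp [Submodule.one_eq_span]
  | cons q l ih =>
    rw [List.nodup_cons] at hl
    rw [List.map_cons, List.prod_cons, ih hl.2, Submodule.span_mul_span]
    congr 1
    ext x
    simp only [Set.mem_mul, Set.mem_range, List.map_cons, List.prod_cons]
    constructor
    · rintro ⟨_, ⟨a, rfl⟩, _, ⟨k, rfl⟩, rfl⟩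
      classical
      refine ⟨Function.update k q a, ?_⟩
      rw [Function.update_self]
      congr 2
      refine List.map_congr_left fun p hp => ?_
      rw [Function.update_of_ne]
      rintro rfl
      exact hl.1 hp
    · rintro ⟨k, rfl⟩
      exact ⟨_, ⟨k q, rfl⟩, _, ⟨k, rfl⟩, rfl⟩

end IsRootFamily
end OrderedProducts

/-! ### Abstract divided power relations. -/

section OrderedProducts

variable {𝕜 A : Type*} [CommRing 𝕜] [Ring A] [Algebra 𝕜 A] {n : ℕ}

/-- Elements satisfying the relations between the divided powers of the root vectors `e_{ij}`. -/
structure IsDividedPowerSystem (g : PosRoot n → ℕ → A) : Prop where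
  zero (p) : g p 0 = 1
  mul_self (p a b) : g p a * g p b = ((a + b).choose a) • g p (a + b)
  comm (p q a b) (h : p.1.2 ≠ q.1.1) (h' : q.1.2 ≠ p.1.1) : g p a * g q b = g q b * g p a
  add (p q a b) (h : p.1.2 = q.1.1) : g p a * g q b = ∑ s ∈ Finset.range (a + 1),
    (if s ≤ b then g q (b - s) else 0) * g (p.add q h) s * g p (a - s)

namespace IsDividedPowerSystem

variable {g : PosRoot n → ℕ → A} (hg : IsDividedPowerSystem g)
include hg

lemma map {B : Type*} [Ring B] (f : A →+* B) : IsDividedPowerSystem fun p k => f (g p k) where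
  zero p := by simp [hg.zero]
  mul_self p a b := by rw [← map_mul, hg.mul_self, map_nsmul]
  comm p q a b h h' := by rw [← map_mul, hg.comm p q a b h h', map_mul]
  add p q a b h := by
    rw [← map_mul, hg.add p q a b h, map_sum]
    refine Finset.sum_congr rfl fun s _ => ?_
    split_ifs <;> simp

variable (𝕜) in
lemma isRootFamily : IsRootFamily fun p => Submodule.span 𝕜 (Set.range (g p)) where
  one_le p := by
    rw [Submodule.one_le, ← hg.zero p]
    exact Submodule.subset_span ⟨0, rfl⟩
  mul_self_le p := by
    rw [Submodule.span_mul_span, Submodule.span_le]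
    rintro _ ⟨_, ⟨a, rfl⟩, _, ⟨b, rfl⟩, rfl⟩
    simp only [hg.mul_self]
    exact nsmul_mem (Submodule.subset_span (Set.mem_range_self _)) _
  comm_le p q h h' := by
    rw [Submodule.span_mul_span, Submodule.span_le]
    rintro _ ⟨_, ⟨a, rfl⟩, _, ⟨b, rfl⟩, rfl⟩
    simp only [hg.comm p q a b h h']
    exact Submodule.mul_mem_mul (Submodule.subset_span ⟨_, rfl⟩) (Submodule.subset_span ⟨_, rfl⟩)
  add_le p q h := by
    rw [Submodule.span_mul_span, Submodule.span_le]
    rintro _ ⟨_, ⟨a, rfl⟩, _, ⟨b, rfl⟩, rfl⟩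
    simp only [hg.add p q a b h]
    refine sum_mem fun s _ => Submodule.mul_mem_mul (Submodule.mul_mem_mul ?_
      (Submodule.subset_span ⟨_, rfl⟩)) (Submodule.subset_span ⟨_, rfl⟩)
    split_ifs
    · exact Submodule.subset_span ⟨_, rfl⟩
    · exact zero_mem _

end IsDividedPowerSystem
end OrderedProducts

/-! ### Ordered products span the Kostant form. -/

section Kostant

variable {n : ℕ}

/-- When two roots add up, their bracket commutes with both root vectors, so the Heisenberg formula
applies. -/
lemma PosRoot.isDividedPowerSystem_divPow : IsDividedPowerSystem (EnvAlg.divPow (n := n)) where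
  zero p := dividedPow_zero (𝕜 := ℂ) _
  mul_self p a b := dividedPow_mul_dividedPow (𝕜 := ℂ) _ a b
  comm p q a b h h' := by
    refine Commute.dividedPow_dividedPow (𝕜 := ℂ) ?_ a b
    have := EnvAlg.e_lie p q
    rw [EnvAlg.lie_e_of_ne p q h h', map_zero] at this
    exact sub_eq_zero.mp this.symm
  add p q a b h := by
    obtain ⟨⟨i, j⟩, hij⟩ := p
    obtain ⟨⟨j', k⟩, hjk⟩ := q
    obtain rfl : j = j' := h
    have h1 := EnvAlg.e_lie (⟨(i, j), hij⟩ : PosRoot n) ⟨(j, k), hjk⟩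
    rw [EnvAlg.lie_e i j k hij hjk] at h1
    have hc : ∀ p q : PosRoot n, p.1.2 ≠ q.1.1 → q.1.2 ≠ p.1.1 →
        Commute (EnvAlg.e p) (EnvAlg.e q) := by
      intro p q h h'
      have := EnvAlg.e_lie p q
      rw [EnvAlg.lie_e_of_ne p q h h', map_zero] at this
      exact sub_eq_zero.mp this.symm
    refine dividedPow_mul_dividedPow_of_lie (𝕜 := ℂ) ?_ (hc _ _ hij.ne' (hij.trans hjk).ne')
      (hc _ _ (hij.trans hjk).ne' hjk.ne') a b
    rw [PosRoot.add]
    simp only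
    rw [← sub_eq_iff_eq_add', ← h1]
    rfl

lemma kostantZ.isDividedPowerSystem : IsDividedPowerSystem (kostantZ.divPow (n := n)) := by
  have h := PosRoot.isDividedPowerSystem_divPow (n := n)
  constructor
  · exact fun p => Subtype.ext (h.zero p)
  · intro p a b
    refine Subtype.ext ((h.mul_self p a b).trans ?_)
    rw [AddSubmonoidClass.coe_nsmul]; rfl
  · exact fun p q a b hpq hqp => Subtype.ext (h.comm p q a b hpq hqp)
  · intro p q a b hpq
    refine Subtype.ext ((h.add p q a b hpq).trans ?_)
    rw [AddSubmonoidClass.coe_finsetSum]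
    refine Finset.sum_congr rfl fun s _ => ?_
    split_ifs <;> rfl

/-- The ordered product of divided powers in the Kostant form over `ℤ`. -/
noncomputable def kostantZ.monomial (k : PosRoot n → ℕ) : kostantZ n :=
  ((PosRoot.list n).map fun p => kostantZ.divPow p (k p)).prod

/-- The straightening coefficients are integers. So the ℤ-span of the ordered products contains 1
and the generators and is closed under multiplication. -/
lemma kostantZ.span_monomial : Submodule.span ℤ (Set.range (kostantZ.monomial (n := n))) = ⊤ := by
  have hE := (kostantZ.isDividedPowerSystem (n := n)).isRootFamily ℤ
  have h1 := IsRootFamily.prod_map_span_range (𝕜 := ℤ) (kostantZ.divPow (n := n))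
    (PosRoot.nodup_list n)
  have h2 := hE.mul_prod_le (PosRoot.pairwise_list n) (fun _ _ _ _ _ => PosRoot.mem_list _)
  have h3 := hE.one_le_prod (PosRoot.list n)
  have h4 := hE.prod_mul_prod_le (PosRoot.pairwise_list n) (fun _ _ _ _ _ => PosRoot.mem_list _)
  change Submodule.span ℤ (Set.range fun k : PosRoot n → ℕ =>
    ((PosRoot.list n).map fun p => kostantZ.divPow p (k p)).prod) = ⊤
  rw [← h1]
  set V := ((PosRoot.list n).map fun p => Submodule.span ℤ (Set.range (kostantZ.divPow p))).prod
  rw [eq_top_iff]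
  rintro ⟨x, hx⟩ -
  induction hx using Algebra.adjoin_induction with
  | mem x hx =>
    obtain ⟨p, k, rfl⟩ := hx
    have := h2 p (PosRoot.mem_list p) (Submodule.mul_mem_mul (Submodule.subset_span ⟨k, rfl⟩)
      (Submodule.one_le.mp h3))
    rwa [mul_one] at this
  | algebraMap r =>
    have := V.smul_mem r (Submodule.one_le.mp h3)
    rwa [← Algebra.algebraMap_eq_smul_one] at this
  | add x y hx hy h h' => exact add_mem h h'
  | mul x y hx hy h h' => exact h4 (Submodule.mul_mem_mul h h')

end Kostant

/-! ### Linear independence through a polynomial representation. -/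

section PBW

attribute [local instance 100] LieRing.ofAssociativeRing

variable (n : ℕ)

open MvPolynomial

/-- The derivation of `ℂ[x_{ij}]` given by left multiplication by `M` on generic matrices. -/
noncomputable def matDerivation (M : Matrix (Fin n) (Fin n) ℂ) :
    Derivation ℂ (MvPolynomial (Fin n × Fin n) ℂ) (MvPolynomial (Fin n × Fin n) ℂ) :=
  mkDerivation ℂ fun p => ∑ i, M i p.1 • X (i, p.2)

lemma matDerivation_X (M : Matrix (Fin n) (Fin n) ℂ) (p : Fin n × Fin n) :
    matDerivation n M (X p) = ∑ i, M i p.1 • X (i, p.2) := mkDerivation_X ..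

lemma matDerivation_add (M N : Matrix (Fin n) (Fin n) ℂ) :
    matDerivation n (M + N) = matDerivation n M + matDerivation n N := by
  refine derivation_ext fun p => ?_
  simp [matDerivation_X, add_smul, Finset.sum_add_distrib]

lemma matDerivation_smul (c : ℂ) (M : Matrix (Fin n) (Fin n) ℂ) :
    matDerivation n (c • M) = c • matDerivation n M := by
  refine derivation_ext fun p => ?_
  simp [matDerivation_X, mul_smul, Finset.smul_sum]

/-- A composite of derivations is not a derivation, so this holds on variables only; that determines
the commutator, which is one. -/
lemma matDerivation_matDerivation_X (M N : Matrix (Fin n) (Fin n) ℂ) (p : Fin n × Fin n) :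
    matDerivation n M (matDerivation n N (X p)) = matDerivation n (M * N) (X p) := by
  simp only [matDerivation_X, map_sum, Derivation.map_smul, Matrix.mul_apply, Finset.smul_sum,
    Finset.sum_smul]
  rw [Finset.sum_comm]
  refine Finset.sum_congr rfl fun i _ => Finset.sum_congr rfl fun j _ => ?_
  rw [smul_smul, mul_comm]

lemma matDerivation_sub (M N : Matrix (Fin n) (Fin n) ℂ) :
    matDerivation n (M - N) = matDerivation n M - matDerivation n N := by
  refine derivation_ext fun p => ?_
  simp [matDerivation_X, sub_smul, Finset.sum_sub_distrib]

lemma matDerivation_lie (M N : Matrix (Fin n) (Fin n) ℂ) :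
    matDerivation n (M * N - N * M) = ⁅matDerivation n M, matDerivation n N⁆ := by
  refine derivation_ext fun p => ?_
  rw [Derivation.commutator_apply, matDerivation_matDerivation_X, matDerivation_matDerivation_X,
    matDerivation_sub]
  rfl

/-- The trace of the generic matrix. -/
noncomputable def genTrace : MvPolynomial (Fin n × Fin n) ℂ := ∑ l, X (l, l)

/-- The action of a matrix on `ℂ[x_{ij}]`, twisted by the exponential of the trace. -/
noncomputable def twistedAction :
    Matrix (Fin n) (Fin n) ℂ →ₗ[ℂ] Module.End ℂ (MvPolynomial (Fin n × Fin n) ℂ) where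
  toFun M := (matDerivation n M : MvPolynomial (Fin n × Fin n) ℂ →ₗ[ℂ] _) +
    LinearMap.mulLeft ℂ (matDerivation n M (genTrace n))
  map_add' M N := by
    refine LinearMap.ext fun f => ?_
    simp [matDerivation_add, add_mul]
    ring
  map_smul' c M := by
    refine LinearMap.ext fun f => ?_
    simp [matDerivation_smul]

lemma twistedAction_apply (M : Matrix (Fin n) (Fin n) ℂ) (f : MvPolynomial (Fin n × Fin n) ℂ) :
    twistedAction n M f = matDerivation n M f + matDerivation n M (genTrace n) * f := rfl

/-- The representation of `sl_n^+` on `ℂ[x_{ij}]`. -/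
noncomputable def slPlusRep :
    slPlus n →ₗ⁅ℂ⁆ Module.End ℂ (MvPolynomial (Fin n × Fin n) ℂ) :=
  { (twistedAction n).comp (slPlus n).toSubmodule.subtype with
    map_lie' := by
      intro x y
      refine LinearMap.ext fun f => ?_
      change twistedAction n (x.1 * y.1 - y.1 * x.1) f = twistedAction n x.1 (twistedAction n y.1 f)
        - twistedAction n y.1 (twistedAction n x.1 f)
      simp only [twistedAction_apply, matDerivation_lie, Derivation.commutator_apply, map_add,
        Derivation.leibniz, smul_eq_mul]
      ring }

/-- The representation of the enveloping algebra on `ℂ[x_{ij}]`. -/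
noncomputable def envRep : EnvAlg n →ₐ[ℂ] Module.End ℂ (MvPolynomial (Fin n × Fin n) ℂ) :=
  UniversalEnvelopingAlgebra.lift ℂ (slPlusRep n)

variable {n}

lemma matDerivation_single_X (p : PosRoot n) (q : Fin n × Fin n) :
    matDerivation n (Matrix.single p.1.1 p.1.2 1) (X q) =
      if p.1.2 = q.1 then X (p.1.1, q.2) else 0 := by
  rw [matDerivation_X]
  split_ifs with h
  · rw [Finset.sum_eq_single p.1.1]
    · simp [h]
    · intro i _ hi
      rw [Matrix.single_apply_of_ne _ _ _ _ _ (fun h => hi h.1.symm), zero_smul]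
    · simp
  · refine Finset.sum_eq_zero fun i _ => ?_
    rw [Matrix.single_apply_of_ne _ _ _ _ _ (fun h' => h h'.2), zero_smul]

/-- The reason for twisting by the trace: `e p` applied to 1 now gives the variable `X p.1` instead
of 0. -/
lemma matDerivation_single_genTrace (p : PosRoot n) :
    matDerivation n (Matrix.single p.1.1 p.1.2 1) (genTrace n) = X p.1 := by
  rw [genTrace, map_sum]
  simp [matDerivation_single_X]

lemma envRep_e (p : PosRoot n) (f : MvPolynomial (Fin n × Fin n) ℂ) :
    envRep n (EnvAlg.e p) f =
      matDerivation n (Matrix.single p.1.1 p.1.2 1) f + X p.1 * f := by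
  rw [← matDerivation_single_genTrace p, ← twistedAction_apply, envRep, EnvAlg.e,
    UniversalEnvelopingAlgebra.lift_ι_apply]
  rfl

lemma envRep_e_pow (p : PosRoot n) (k : ℕ) (f : MvPolynomial (Fin n × Fin n) ℂ)
    (hf : matDerivation n (Matrix.single p.1.1 p.1.2 1) f = 0) :
    envRep n (EnvAlg.e p ^ k) f = X p.1 ^ k * f := by
  have hX : matDerivation n (Matrix.single p.1.1 p.1.2 1) (X p.1) = 0 := by
    rw [matDerivation_single_X, if_neg p.2.ne']
  induction k with
  | zero => simp
  | succ k ih =>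
    rw [pow_succ', map_mul, Module.End.mul_apply, ih, envRep_e, Derivation.leibniz,
      Derivation.leibniz_pow, hf, hX]
    simp only [smul_zero, zero_add]
    ring

/-- The derivation part of a factor `q` kills every variable produced by the factors on its right:
their rows are smaller than the column of `q`. Only multiplication by the variable of `q` remains.
-/
lemma envRep_prod_one (k : PosRoot n → ℕ) {l : List (PosRoot n)}
    (hl : l.Pairwise PosRoot.Before) :
    envRep n ((l.map fun p => EnvAlg.divPow p (k p)).prod) 1 =
      (l.map fun p => ((k p).factorial : ℂ)⁻¹).prod •
        (l.map fun p => (X p.1 : MvPolynomial (Fin n × Fin n) ℂ) ^ k p).prod := by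
  induction l with
  | nil => simp
  | cons q l ih =>
    rw [List.pairwise_cons] at hl
    simp only [List.map_cons, List.prod_cons]
    rw [map_mul, Module.End.mul_apply, ih hl.2, map_smul, EnvAlg.divPow, map_smul,
      LinearMap.smul_apply, envRep_e_pow, smul_smul, mul_comm]
    have : ∀ l' : List (PosRoot n), (∀ p ∈ l', q.Before p) →
        matDerivation n (Matrix.single q.1.1 q.1.2 1)
          (l'.map fun p => (X p.1 : MvPolynomial (Fin n × Fin n) ℂ) ^ k p).prod = 0 := by
      intro l'
      induction l' with
      | nil => simp
      | cons p l' ih' =>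
        intro h
        have hp : q.1.2 ≠ p.1.1 := by
          rcases h p (List.mem_cons_self ..) with h | h
          · exact (p.2.trans h).ne'
          · exact (p.2.trans_eq h.1).ne'
        rw [List.map_cons, List.prod_cons, Derivation.leibniz,
          ih' fun p hp => h p (List.mem_cons_of_mem _ hp), Derivation.leibniz_pow,
          matDerivation_single_X, if_neg hp]
        simp
    exact this l hl.1

/-- Ordered products of divided powers are linearly independent. -/
lemma EnvAlg.linearIndependent_monomial : LinearIndependent ℂ fun k : PosRoot n → ℕ =>
    ((PosRoot.list n).map fun p => EnvAlg.divPow p (k p)).prod := by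
  let φ : EnvAlg n →ₗ[ℂ] MvPolynomial (Fin n × Fin n) ℂ :=
    (LinearMap.applyₗ 1).comp (envRep n).toLinearMap
  refine LinearIndependent.of_comp φ ?_
  let m : (PosRoot n → ℕ) → (Fin n × Fin n →₀ ℕ) := fun k =>
    ∑ p : PosRoot n, Finsupp.single p.1 (k p)
  have hm : Function.Injective m := by
    have h : ∀ (k : PosRoot n → ℕ) (p : PosRoot n), m k p.1 = k p := by
      intro k p
      rw [Finsupp.finsetSum_apply, Finset.sum_eq_single p]
      · simp
      · exact fun q _ hq => Finsupp.single_eq_of_ne fun h => hq (Subtype.ext h.symm)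
      · simp
    exact fun k k' hk => funext fun p => by rw [← h k, hk, h]
  have h0 : ∀ k : PosRoot n → ℕ,
      ((PosRoot.list n).map fun p => ((k p).factorial : ℂ)⁻¹).prod ≠ 0 := by
    intro k
    exact List.prod_ne_zero (by simp [Nat.factorial_ne_zero])
  -- The images are distinct monomials rescaled by inverse factorials, which are units of ℂ.
  have h1 := (((basisMonomials (Fin n × Fin n) ℂ).linearIndependent.comp m hm).units_smul
    fun k => Units.mk0 _ (h0 k))
  suffices h2 : (⇑φ ∘ fun k : PosRoot n → ℕ =>
      ((PosRoot.list n).map fun p => EnvAlg.divPow p (k p)).prod) =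
      (fun k => Units.mk0 _ (h0 k)) • ((basisMonomials (Fin n × Fin n) ℂ) ∘ m) by
    rw [h2]
    exact h1
  funext k
  change envRep n _ 1 = _
  rw [envRep_prod_one k (PosRoot.pairwise_list n)]
  simp only [Pi.smul_apply', Function.comp_apply, coe_basisMonomials, Units.smul_mk0]
  congr 1
  have hf : (PosRoot.list n).toFinset = Finset.univ := by
    ext p; simp [PosRoot.mem_list]
  rw [← List.prod_toFinset _ (PosRoot.nodup_list n), hf]
  change _ = MvPolynomial.monomial (∑ p : PosRoot n, Finsupp.single p.1 (k p)) 1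
  rw [monomial_sum_one]
  exact Finset.prod_congr rfl fun p _ => X_pow_eq_monomial

end PBW

lemma kostantZ.linearIndependent_monomial (n : ℕ) :
    LinearIndependent ℤ (kostantZ.monomial (n := n)) := by
  have h1 : LinearIndependent ℤ fun k : PosRoot n → ℕ =>
      ((PosRoot.list n).map fun p => EnvAlg.divPow p (k p)).prod :=
    EnvAlg.linearIndependent_monomial.restrict_scalars' ℤ
  refine LinearIndependent.of_comp (kostantZ n).val.toLinearMap ?_
  have h2 : (⇑(kostantZ n).val.toLinearMap ∘ kostantZ.monomial) = fun k : PosRoot n → ℕ =>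
      ((PosRoot.list n).map fun p => EnvAlg.divPow p (k p)).prod := by
    funext k
    change (kostantZ n).val _ = _
    rw [kostantZ.monomial, map_list_prod, List.map_map]
    rfl
  rw [h2]
  exact h1

/-- The basis of the Kostant form over `ℤ` given by the ordered products of divided powers. -/
noncomputable def kostantZ.basis (n : ℕ) : Module.Basis (PosRoot n → ℕ) ℤ (kostantZ n) :=
  Module.Basis.mk (kostantZ.linearIndependent_monomial n) kostantZ.span_monomial.ge

/-! ### The PBW basis over `K` and spans of exponents. -/

namespace KostantAlg

variable (K : Type u) [Field K] (n : ℕ)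

/-- The basis of `𝔄_n(K)` given by the ordered products of divided powers. -/
noncomputable def basis : Module.Basis (PosRoot n → ℕ) K (KostantAlg K n) :=
  (kostantZ.basis n).baseChange K

lemma isDividedPowerSystem : IsDividedPowerSystem (KostantAlg.divPow K (n := n)) :=
  kostantZ.isDividedPowerSystem.map
    (Algebra.TensorProduct.includeRight : kostantZ n →ₐ[ℤ] K ⊗[ℤ] kostantZ n).toRingHom

variable {n}

lemma basis_apply (k : PosRoot n → ℕ) :
    basis K n k = ((PosRoot.list n).map fun p => KostantAlg.divPow K p (k p)).prod := by
  rw [basis, Module.Basis.baseChange_apply, kostantZ.basis, Module.Basis.mk_apply,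
    kostantZ.monomial]
  change (Algebra.TensorProduct.includeRight : kostantZ n →ₐ[ℤ] K ⊗[ℤ] kostantZ n) _ = _
  rw [map_list_prod, List.map_map]
  rfl

lemma monomial_eq_basis (k : Matrix (Fin n) (Fin n) ℕ) :
    KostantAlg.monomial K k = basis K n fun p => k p.1.1 p.1.2 := (basis_apply K _).symm

end KostantAlg

/-- The degree of the ordered product of divided powers with exponents `k`. -/
noncomputable def PosRoot.expDeg {n : ℕ} (k : PosRoot n → ℕ) : Psi n :=
  ((PosRoot.list n).map fun p => k p • p.deg).sum

namespace KostantAlg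

variable (K : Type u) [Field K] {n : ℕ}

lemma basis_mem_grading (k : PosRoot n → ℕ) :
    basis K n k ∈ KostantAlg.grading K n (PosRoot.expDeg k) := by
  rw [basis_apply, PosRoot.expDeg]
  exact SetLike.list_prod_map_mem_graded _ _ _ fun p _ => KostantAlg.divPow_mem K p (k p)

/-- The span of the ordered products with exponents in `𝒦`. -/
noncomputable def expSpan (𝒦 : Set (PosRoot n → ℕ)) : Submodule K (KostantAlg K n) :=
  Submodule.span K (basis K n '' 𝒦)

variable {K}

lemma mem_expSpan {𝒦 : Set (PosRoot n → ℕ)} {a : KostantAlg K n} :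
    a ∈ expSpan K 𝒦 ↔ (((basis K n).repr a).support : Set (PosRoot n → ℕ)) ⊆ 𝒦 := (basis K n).mem_span_image

lemma basis_mem_expSpan {𝒦 : Set (PosRoot n → ℕ)} {k : PosRoot n → ℕ} (hk : k ∈ 𝒦) :
    basis K n k ∈ expSpan K 𝒦 := Submodule.subset_span ⟨k, hk, rfl⟩

lemma expSpan_mono {𝒦 ℒ : Set (PosRoot n → ℕ)} (h : 𝒦 ⊆ ℒ) : expSpan K 𝒦 ≤ expSpan K ℒ :=
  Submodule.span_mono (Set.image_mono h)

lemma expSpan_univ : expSpan K (Set.univ : Set (PosRoot n → ℕ)) = ⊤ := by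
  rw [expSpan, Set.image_univ, (basis K n).span_eq]

lemma expSpan_union (𝒦 ℒ : Set (PosRoot n → ℕ)) :
    expSpan K (𝒦 ∪ ℒ) = expSpan K 𝒦 ⊔ expSpan K ℒ := by
  rw [expSpan, Set.image_union, Submodule.span_union]; rfl

lemma expSpan_inter (𝒦 ℒ : Set (PosRoot n → ℕ)) :
    expSpan K (𝒦 ∩ ℒ) = expSpan K 𝒦 ⊓ expSpan K ℒ := by
  ext a
  simp only [Submodule.mem_inf, mem_expSpan, Set.subset_inter_iff]

/-- The basis is homogeneous, so the projection to degree `γ` keeps or kills each basis vector. -/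
lemma grading_le_expSpan (γ : Psi n) :
    KostantAlg.grading K n γ ≤ expSpan K {k | PosRoot.expDeg k = γ} := by
  intro a ha
  have key : ∀ a : KostantAlg K n, ((DirectSum.decompose (KostantAlg.grading K n) a γ :
      KostantAlg.grading K n γ) : KostantAlg K n) ∈ expSpan K {k | PosRoot.expDeg k = γ} := by
    intro a
    induction (basis K n).mem_span a using Submodule.span_induction with
    | mem x hx =>
      obtain ⟨k, rfl⟩ := hx
      by_cases h : PosRoot.expDeg k = γ
      · subst h
        rw [DirectSum.decompose_of_mem_same _ (basis_mem_grading K k)]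
        exact basis_mem_expSpan rfl
      · rw [DirectSum.decompose_of_mem_ne _ (basis_mem_grading K k) h]
        exact zero_mem _
    | zero => rw [DirectSum.decompose_zero]; exact zero_mem _
    | add x y _ _ hx hy =>
      rw [DirectSum.decompose_add, DirectSum.add_apply, Submodule.coe_add]
      exact add_mem hx hy
    | smul c x _ hx =>
      rw [DirectSum.decompose_smul, DirectSum.smul_apply, Submodule.coe_smul]
      exact Submodule.smul_mem _ _ hx
  rw [← DirectSum.decompose_of_mem_same _ ha]
  exact key a

end KostantAlg

/-! ### Cutting exponents at a column. -/

namespace PosRoot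

variable {n : ℕ}

/-- The exponents supported in columns `≤ m`. -/
def Low (m : Fin n) : Set (PosRoot n → ℕ) := {k | ∀ p : PosRoot n, m < p.1.2 → k p = 0}

/-- The exponents supported in columns `> m`. -/
def High (m : Fin n) : Set (PosRoot n → ℕ) := {k | ∀ p : PosRoot n, p.1.2 ≤ m → k p = 0}

/-- The part of `k` in columns `≤ m`. -/
def lowPart (m : Fin n) (k : PosRoot n → ℕ) : PosRoot n → ℕ := fun p => if p.1.2 ≤ m then k p else 0

/-- The part of `k` in columns `> m`. -/
def highPart (m : Fin n) (k : PosRoot n → ℕ) : PosRoot n → ℕ :=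
  fun p => if p.1.2 ≤ m then 0 else k p

lemma lowPart_mem (m : Fin n) (k : PosRoot n → ℕ) : lowPart m k ∈ Low m :=
  fun _ hp => if_neg (not_le.mpr hp)

lemma highPart_mem (m : Fin n) (k : PosRoot n → ℕ) : highPart m k ∈ High m := fun _ hp => if_pos hp

lemma lowPart_add {m : Fin n} {c l : PosRoot n → ℕ} (hc : c ∈ High m) (hl : l ∈ Low m) :
    lowPart m (c + l) = l := by
  funext p
  rw [lowPart]
  split_ifs with h
  · simp [hc p h]
  · exact (hl p (not_le.mp h)).symm

lemma highPart_add {m : Fin n} {c l : PosRoot n → ℕ} (hc : c ∈ High m) (hl : l ∈ Low m) :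
    highPart m (c + l) = c := by
  funext p
  rw [highPart]
  split_ifs with h
  · exact (hc p h).symm
  · simp [hl p (not_le.mp h)]

lemma highPart_add_lowPart (m : Fin n) (k : PosRoot n → ℕ) : highPart m k + lowPart m k = k := by
  funext p
  rw [Pi.add_apply, highPart, lowPart]
  split_ifs <;> simp

/-- Columns decrease along the list, so the factors in columns `> m` form an initial segment. Every
ordered product is thus a high part times a low part. -/
lemma list_eq_append (m : Fin n) : PosRoot.list n =
    (PosRoot.list n).filter (fun p => ¬ p.1.2 ≤ m) ++ (PosRoot.list n).filter (fun p => p.1.2 ≤ m) := by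
  have h := pairwise_list n
  revert h
  generalize PosRoot.list n = l
  intro h
  induction l with
  | nil => rfl
  | cons q l ih =>
    rw [List.pairwise_cons] at h
    by_cases hq : q.1.2 ≤ m
    · have h1 : ∀ p ∈ q :: l, p.1.2 ≤ m := by
        intro p hp
        rcases List.mem_cons.mp hp with rfl | hp
        · exact hq
        · rcases h.1 p hp with h | h
          · exact h.le.trans hq
          · exact h.1.le.trans hq
      rw [List.filter_eq_nil_iff.mpr (by simpa using h1), List.filter_eq_self.mpr (by simpa using h1),
        List.nil_append]
    · rw [List.filter_cons_of_pos (by simpa using hq), List.filter_cons_of_neg (by simpa using hq),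
        List.cons_append, ← ih h.2]

lemma expDeg_eq_sum (k : PosRoot n → ℕ) : expDeg k = ∑ p, k p • p.deg := by
  have hf : (PosRoot.list n).toFinset = Finset.univ := by
    ext p; simp [PosRoot.mem_list]
  rw [expDeg, ← List.sum_toFinset _ (PosRoot.nodup_list n), hf]

/-- The sum of the exponents in column `m`. -/
def colSum (m : Fin n) (k : PosRoot n → ℕ) : ℕ := ∑ p : PosRoot n, if p.1.2 = m then k p else 0

lemma coe_expDeg (k : PosRoot n → ℕ) (i : Fin n) : (expDeg k : Fin n → ℤ) i =
    (∑ p : PosRoot n, if p.1.1 = i then (k p : ℤ) else 0) - colSum i k := by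
  rw [expDeg_eq_sum, colSum, AddSubmonoidClass.coe_finsetSum, Finset.sum_apply, Nat.cast_sum,
    ← Finset.sum_sub_distrib]
  refine Finset.sum_congr rfl fun p _ => ?_
  rw [AddSubmonoidClass.coe_nsmul, Pi.smul_apply, deg]
  simp only [Pi.sub_apply, Pi.single_apply, eq_comm (a := i)]
  split_ifs <;> simp

/-- A root in row `m` has column `> m`, so row `m` of a low exponent is zero and only column `m`
contributes. -/
lemma coe_expDeg_of_mem_low {m : Fin n} {k : PosRoot n → ℕ} (hk : k ∈ Low m) :
    (expDeg k : Fin n → ℤ) m = - colSum m k := by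
  rw [coe_expDeg, Finset.sum_eq_zero, zero_sub]
  intro p _
  split_ifs with h
  · rw [hk p (h ▸ p.2), Nat.cast_zero]
  · rfl

lemma colSum_lowPart {m j : Fin n} (h : j ≤ m) (k : PosRoot n → ℕ) :
    colSum j (lowPart m k) = colSum j k := by
  refine Finset.sum_congr rfl fun p _ => ?_
  split_ifs with hp
  · rw [lowPart, if_pos (hp ▸ h)]
  · rfl

end PosRoot

/-! ### Freeness over the columns `≤ m`, and left ideals spanned by exponents. -/

namespace KostantAlg

variable {K : Type u} [Field K] {n : ℕ}

open PosRoot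

lemma basis_of_mem_low {m : Fin n} {k : PosRoot n → ℕ} (hk : k ∈ Low m) : basis K n k =
    (((PosRoot.list n).filter (fun p => p.1.2 ≤ m)).map
      fun p => KostantAlg.divPow K p (k p)).prod := by
  rw [basis_apply]
  conv_lhs => rw [list_eq_append m, List.map_append, List.prod_append]
  have h1 : ((((PosRoot.list n).filter (fun p => ¬ p.1.2 ≤ m)).map
      fun p => KostantAlg.divPow K p (k p))).prod = 1 := by
    refine List.prod_eq_one fun x hx => ?_
    obtain ⟨p, hp, rfl⟩ := List.mem_map.mp hx
    rw [hk p (by simpa using (List.mem_filter.mp hp).2), (isDividedPowerSystem K n).zero]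
  rw [h1, one_mul]

lemma basis_of_mem_high {m : Fin n} {k : PosRoot n → ℕ} (hk : k ∈ High m) : basis K n k =
    (((PosRoot.list n).filter (fun p => ¬ p.1.2 ≤ m)).map
      fun p => KostantAlg.divPow K p (k p)).prod := by
  rw [basis_apply]
  conv_lhs => rw [list_eq_append m, List.map_append, List.prod_append]
  have h1 : ((((PosRoot.list n).filter (fun p => p.1.2 ≤ m)).map
      fun p => KostantAlg.divPow K p (k p))).prod = 1 := by
    refine List.prod_eq_one fun x hx => ?_
    obtain ⟨p, hp, rfl⟩ := List.mem_map.mp hx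
    rw [hk p (by simpa using (List.mem_filter.mp hp).2), (isDividedPowerSystem K n).zero]
  rw [h1, mul_one]

lemma basis_mul_basis {m : Fin n} {c l : PosRoot n → ℕ} (hc : c ∈ High m) (hl : l ∈ Low m) :
    basis K n c * basis K n l = basis K n (c + l) := by
  rw [basis_of_mem_high hc, basis_of_mem_low hl, basis_apply]
  conv_rhs => rw [list_eq_append m, List.map_append, List.prod_append]
  congr 2
  · refine List.map_congr_left fun p hp => ?_
    rw [Pi.add_apply, hl p (by simpa using (List.mem_filter.mp hp).2), add_zero]
  · refine List.map_congr_left fun p hp => ?_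
    rw [Pi.add_apply, hc p (by simpa using (List.mem_filter.mp hp).2), zero_add]

/-- Presents the low span as an ordered product of root families, so that `prod_mul_prod_le` makes
it a subalgebra. -/
lemma expSpan_low (m : Fin n) : expSpan K (Low m) =
    (((PosRoot.list n).filter (fun p => p.1.2 ≤ m)).map
      fun p => Submodule.span K (Set.range (KostantAlg.divPow K p))).prod := by
  rw [IsRootFamily.prod_map_span_range _ ((nodup_list n).filter _), expSpan]
  congr 1
  ext x
  simp only [Set.mem_image, Set.mem_range]
  constructor
  · rintro ⟨k, hk, rfl⟩
    exact ⟨k, (basis_of_mem_low hk).symm⟩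
  · rintro ⟨k, rfl⟩
    refine ⟨lowPart m k, lowPart_mem m k, ?_⟩
    rw [basis_of_mem_low (lowPart_mem m k)]
    congr 1
    refine List.map_congr_left fun p hp => ?_
    rw [lowPart, if_pos (by simpa using (List.mem_filter.mp hp).2)]

lemma mul_mem_expSpan_low {m : Fin n} {a b : KostantAlg K n} (ha : a ∈ expSpan K (Low m))
    (hb : b ∈ expSpan K (Low m)) : a * b ∈ expSpan K (Low m) := by
  rw [expSpan_low] at ha hb ⊢
  refine ((isDividedPowerSystem K n).isRootFamily K).prod_mul_prod_le
    ((pairwise_list n).filter _) ?_ (Submodule.mul_mem_mul ha hb)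
  intro p hp q hq h
  rw [List.mem_filter] at hq ⊢
  exact ⟨mem_list _, hq.2⟩

/-- Left multiplication by elements of columns `≤ m` does not decrease the sum of column `m`. -/
lemma mul_basis_mem_expSpan {m : Fin n} {a : KostantAlg K n} (ha : a ∈ expSpan K (Low m))
    {l : PosRoot n → ℕ} (hl : l ∈ Low m) :
    a * basis K n l ∈ expSpan K (Low m ∩ {k | colSum m l ≤ colSum m k}) := by
  induction ha using Submodule.span_induction with
  | mem x hx =>
    obtain ⟨k, hk, rfl⟩ := hx
    have h1 := mul_mem_expSpan_low (K := K) (basis_mem_expSpan hk) (basis_mem_expSpan hl)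
    have h2 := grading_le_expSpan _
      (SetLike.mul_mem_graded (basis_mem_grading K k) (basis_mem_grading K l))
    have h3 : basis K n k * basis K n l ∈ expSpan K (Low m ∩ {k' | expDeg k' = expDeg k + expDeg l}) := by
      rw [expSpan_inter]
      exact ⟨h1, h2⟩
    refine expSpan_mono ?_ h3
    rintro k' ⟨hk', h⟩
    refine ⟨hk', ?_⟩
    -- Degrees add, and coordinate `m` of a low degree is minus the sum of column `m`; so these sums
    -- add as well.
    have h := congrArg (fun γ : Psi n => (γ : Fin n → ℤ) m) h
    simp only [AddSubmonoid.coe_add, Pi.add_apply] at h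
    rw [coe_expDeg_of_mem_low hk, coe_expDeg_of_mem_low hl, coe_expDeg_of_mem_low hk'] at h
    change colSum m l ≤ colSum m k'
    omega
  | zero => rw [zero_mul]; exact zero_mem _
  | add x y _ _ hx hy => rw [add_mul]; exact add_mem hx hy
  | smul c x _ hx => rw [smul_mul_assoc]; exact Submodule.smul_mem _ _ hx

/-- `𝔄_n(K)` is free over the part of columns `≤ m`: existence of coordinates. -/
lemma exists_sum_high (m : Fin n) {𝒦 : Set (PosRoot n → ℕ)} (h𝒦 : ∀ k ∈ 𝒦, lowPart m k ∈ 𝒦)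
    {a : KostantAlg K n} (ha : a ∈ expSpan K 𝒦) : ∃ g : High m →₀ KostantAlg K n,
      (∀ c, g c ∈ expSpan K (𝒦 ∩ Low m)) ∧ a = g.sum fun c y => basis K n c.1 * y := by
  classical
  induction ha using Submodule.span_induction with
  | mem x hx =>
    obtain ⟨k, hk, rfl⟩ := hx
    refine ⟨Finsupp.single ⟨highPart m k, highPart_mem m k⟩ (basis K n (lowPart m k)), fun c => ?_, ?_⟩
    · rw [Finsupp.single_apply]
      split_ifs
      · exact basis_mem_expSpan ⟨h𝒦 k hk, lowPart_mem m k⟩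
      · exact zero_mem _
    · rw [Finsupp.sum_single_index (mul_zero _), basis_mul_basis (highPart_mem m k) (lowPart_mem m k),
        highPart_add_lowPart]
  | zero => exact ⟨0, fun c => zero_mem _, by simp⟩
  | add x y _ _ hx hy =>
    obtain ⟨g, hg, rfl⟩ := hx
    obtain ⟨g', hg', rfl⟩ := hy
    refine ⟨g + g', fun c => add_mem (hg c) (hg' c), ?_⟩
    rw [Finsupp.sum_add_index' (fun _ => mul_zero _) (fun _ _ _ => mul_add _ _ _)]
  | smul r x _ hx =>
    obtain ⟨g, hg, rfl⟩ := hx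
    refine ⟨r • g, fun c => Submodule.smul_mem _ _ (hg c), ?_⟩
    rw [Finsupp.sum_smul_index' (fun _ => mul_zero _), Finsupp.smul_sum]
    simp only [mul_smul_comm]

lemma repr_basis_mul {m : Fin n} {c : PosRoot n → ℕ} (hc : c ∈ High m) {a : KostantAlg K n}
    (ha : a ∈ expSpan K (Low m)) (k : PosRoot n → ℕ) :
    (basis K n).repr (basis K n c * a) k =
      if highPart m k = c then (basis K n).repr a (lowPart m k) else 0 := by
  classical
  induction ha using Submodule.span_induction with
  | mem x hx =>
    obtain ⟨l, hl, rfl⟩ := hx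
    rw [basis_mul_basis hc hl, Module.Basis.repr_self, Module.Basis.repr_self,
      Finsupp.single_apply, Finsupp.single_apply]
    by_cases h : c + l = k
    · subst h
      rw [if_pos rfl, if_pos (highPart_add hc hl), if_pos (lowPart_add hc hl).symm]
    · rw [if_neg h]
      split_ifs with h1 h2
      · exact absurd (by rw [← h1, h2, highPart_add_lowPart]) h
      · rfl
      · rfl
  | zero => simp
  | add x y _ _ hx hy =>
    rw [mul_add, map_add, map_add, Finsupp.add_apply, hx, hy, Finsupp.add_apply]
    split_ifs <;> simp
  | smul r x _ hx =>
    rw [mul_smul_comm, map_smul, map_smul, Finsupp.smul_apply, hx, Finsupp.smul_apply]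
    split_ifs <;> simp

/-- `𝔄_n(K)` is free over the part of columns `≤ m`: uniqueness of coordinates. -/
lemma eq_zero_of_sum_high_eq_zero {m : Fin n} {g : High m →₀ KostantAlg K n}
    (hg : ∀ c, g c ∈ expSpan K (Low m)) (h : (g.sum fun c y => basis K n c.1 * y) = 0) :
    g = 0 := by
  ext c
  refine (basis K n).repr.injective (Finsupp.ext fun l => ?_)
  rw [Finsupp.zero_apply, map_zero, Finsupp.zero_apply]
  by_cases hl : l ∈ Low m
  · have h1 := congrArg (fun x => (basis K n).repr x (c.1 + l)) h
    simp only [map_zero, Finsupp.zero_apply] at h1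
    rw [Finsupp.sum, map_sum, Finsupp.finsetSum_apply, Finset.sum_eq_single c] at h1
    · rwa [repr_basis_mul c.2 (hg c), if_pos (highPart_add c.2 hl), lowPart_add c.2 hl] at h1
    · intro c' _ hc'
      rw [repr_basis_mul c'.2 (hg c'), if_neg]
      rw [highPart_add c.2 hl]
      exact fun h => hc' (Subtype.ext h.symm)
    · intro hc
      rw [Finsupp.notMem_support_iff.mp hc]
      simp
  · by_contra h0
    exact hl (mem_expSpan.mp (hg c) (Finsupp.mem_support_iff.mpr h0))

/-- A set of exponents that spans a left ideal. -/
def IsLeftClosed (K : Type u) [Field K] (𝒦 : Set (PosRoot n → ℕ)) : Prop :=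
  ∀ a x : KostantAlg K n, x ∈ expSpan K 𝒦 → a * x ∈ expSpan K 𝒦

lemma isLeftClosed_univ : IsLeftClosed K (Set.univ : Set (PosRoot n → ℕ)) := fun a x _ => by
  rw [expSpan_univ]; trivial

lemma isLeftClosed_empty : IsLeftClosed K (∅ : Set (PosRoot n → ℕ)) := fun a x hx => by
  rw [expSpan, Set.image_empty, Submodule.span_empty, Submodule.mem_bot] at *
  rw [hx, mul_zero]

lemma IsLeftClosed.union {𝒦 ℒ : Set (PosRoot n → ℕ)} (h : IsLeftClosed K 𝒦)
    (h' : IsLeftClosed K ℒ) : IsLeftClosed K (𝒦 ∪ ℒ) := by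
  intro a x hx
  rw [expSpan_union] at *
  obtain ⟨y, hy, z, hz, rfl⟩ := Submodule.mem_sup.mp hx
  rw [mul_add]
  exact add_mem (Submodule.mem_sup_left (h a y hy)) (Submodule.mem_sup_right (h' a z hz))

lemma IsLeftClosed.inter {𝒦 ℒ : Set (PosRoot n → ℕ)} (h : IsLeftClosed K 𝒦)
    (h' : IsLeftClosed K ℒ) : IsLeftClosed K (𝒦 ∩ ℒ) := by
  intro a x hx
  rw [expSpan_inter] at *
  exact ⟨h a x hx.1, h' a x hx.2⟩

/-- Write the monomial as high times low and expand `a` times its high part as high monomials times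
low elements. The low elements do not decrease the sum of column `m` of the low part, and the high
monomials do not involve that column. -/
lemma isLeftClosed_colSum (m : Fin n) (d : ℤ) :
    IsLeftClosed K {k : PosRoot n → ℕ | d < colSum m k} := by
  intro a x hx
  induction hx using Submodule.span_induction with
  | mem x hx =>
    obtain ⟨k, hk, rfl⟩ := hx
    obtain ⟨g, hg, h⟩ := exists_sum_high m (𝒦 := Set.univ) (fun _ _ => trivial)
      (a := a * basis K n (highPart m k)) (by rw [expSpan_univ]; trivial)
    rw [← highPart_add_lowPart m k, ← basis_mul_basis (highPart_mem m k) (lowPart_mem m k),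
      ← mul_assoc, h, Finsupp.sum, Finset.sum_mul]
    refine sum_mem fun c _ => ?_
    have h1 := hg c
    rw [Set.univ_inter] at h1
    have h2 := mul_basis_mem_expSpan h1 (lowPart_mem m k)
    rw [mul_assoc]
    generalize g c * basis K n (lowPart m k) = y at h2 ⊢
    induction h2 using Submodule.span_induction with
    | mem y hy =>
      obtain ⟨l, ⟨hl, hkl⟩, rfl⟩ := hy
      rw [basis_mul_basis c.2 hl]
      refine basis_mem_expSpan ?_
      change d < colSum m (c.1 + l)
      rw [← colSum_lowPart le_rfl, lowPart_add c.2 hl]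
      refine lt_of_lt_of_le hk ?_
      rw [← colSum_lowPart le_rfl k]
      exact_mod_cast hkl
    | zero => rw [mul_zero]; exact zero_mem _
    | add x y _ _ hx hy => rw [mul_add]; exact add_mem hx hy
    | smul c x _ hx => rw [mul_smul_comm]; exact Submodule.smul_mem _ _ hx
  | zero => rw [mul_zero]; exact zero_mem _
  | add x y _ _ hx hy => rw [mul_add]; exact add_mem hx hy
  | smul c x _ hx => rw [mul_smul_comm]; exact Submodule.smul_mem _ _ hx

end KostantAlg

/-! ### Left ideals of the skew product and induced modules. -/

namespace CAlg

variable {K : Type u} [Field K] {n : ℕ}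

open PosRoot KostantAlg

/-- The element `a ⊗ f` of `ℭ_n(K)`. -/
noncomputable def of (a : KostantAlg K n) (f : (Fin n → ℤ) → K) : CAlg K n :=
  SkewProduct.tmul _ _ a f

lemma of_add (a : KostantAlg K n) (f g : (Fin n → ℤ) → K) : of a (f + g) = of a f + of a g :=
  TensorProduct.tmul_add ..

lemma add_of (a b : KostantAlg K n) (f : (Fin n → ℤ) → K) : of (a + b) f = of a f + of b f :=
  TensorProduct.add_tmul ..

lemma smul_of (c : K) (a : KostantAlg K n) (f : (Fin n → ℤ) → K) : of (c • a) f = c • of a f :=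
  TensorProduct.smul_tmul' ..

lemma of_smul (c : K) (a : KostantAlg K n) (f : (Fin n → ℤ) → K) : of a (c • f) = c • of a f :=
  TensorProduct.tmul_smul ..

lemma zero_of (f : (Fin n → ℤ) → K) : of (0 : KostantAlg K n) f = 0 := TensorProduct.zero_tmul ..

lemma one_def : (1 : CAlg K n) = of 1 1 := rfl

@[elab_as_elim]
lemma of_induction {P : CAlg K n → Prop} (h0 : P 0) (ht : ∀ a f, P (of a f))
    (hadd : ∀ x y, P x → P y → P (x + y)) (x : CAlg K n) : P x :=
  TensorProduct.induction_on x h0 ht hadd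

@[elab_as_elim]
lemma basis_induction {P : KostantAlg K n → Prop} (h0 : P 0) (ht : ∀ k, P (basis K n k))
    (hadd : ∀ x y, P x → P y → P (x + y)) (hsmul : ∀ (c : K) x, P x → P (c • x))
    (x : KostantAlg K n) : P x := by
  induction (basis K n).mem_span x using Submodule.span_induction with
  | mem x hx =>
    obtain ⟨k, rfl⟩ := hx
    exact ht k
  | zero => exact h0
  | add x y _ _ hx hy => exact hadd _ _ hx hy
  | smul c x _ hx => exact hsmul _ _ hx

lemma of_mul_of_basis (a : KostantAlg K n) (f g : (Fin n → ℤ) → K) (k : PosRoot n → ℕ) :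
    of a f * of (basis K n k) g =
      of (a * basis K n k) (shift K n (Multiplicative.ofAdd (expDeg k)) f * g) :=
  SkewProduct.tmul_mul_tmul _ _ a f (basis_mem_grading K k) g

lemma of_one_mul_of (a b : KostantAlg K n) (g : (Fin n → ℤ) → K) :
    of a 1 * of b g = of (a * b) g := by
  induction b using basis_induction with
  | h0 => rw [zero_of, mul_zero, mul_zero, zero_of]
  | ht k => rw [of_mul_of_basis, map_one, one_mul]
  | hadd x y hx hy => rw [add_of, mul_add, hx, hy, mul_add, add_of]
  | hsmul c x hx => rw [smul_of, mul_smul_comm, hx, mul_smul_comm, smul_of]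

lemma of_mul_one_of (a : KostantAlg K n) (f g : (Fin n → ℤ) → K) :
    of a f * of 1 g = of a (f * g) := by
  have h := SkewProduct.tmul_mul_tmul (KostantAlg.grading K n) (shift K n) a f
    (SetLike.GradedOne.one_mem (A := KostantAlg.grading K n)) g
  rw [ofAdd_zero, map_one, mul_one] at h
  exact h

lemma of_eq_mul (a : KostantAlg K n) (f : (Fin n → ℤ) → K) : of a f = of a 1 * of 1 f := by
  rw [of_mul_one_of, one_mul]

/-- The indicator function of a point. -/
noncomputable abbrev chi (K : Type u) [Field K] {n : ℕ} (ν : Fin n → ℤ) : (Fin n → ℤ) → K :=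
  Pi.single ν 1

lemma mul_chi (f : (Fin n → ℤ) → K) (ν : Fin n → ℤ) : f * chi K ν = f ν • chi K ν := by
  funext z
  by_cases h : z = ν
  · subst h; simp
  · simp [h]

/-- Each `basis K n k` times `χ_ν` is a weight vector, of weight `expDeg k + ν`. -/
lemma one_of_mul_basis (f : (Fin n → ℤ) → K) (k : PosRoot n → ℕ) (ν : Fin n → ℤ) :
    of 1 f * of (basis K n k) (chi K ν) =
      f ((expDeg k : Fin n → ℤ) + ν) • of (basis K n k) (chi K ν) := by
  rw [of_mul_of_basis, one_mul, mul_chi, of_smul]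
  rfl

lemma one_of_mul_of_chi (f : (Fin n → ℤ) → K) {𝒦 : Set (PosRoot n → ℕ)} {a : KostantAlg K n}
    (ha : a ∈ expSpan K 𝒦) (ν : Fin n → ℤ) :
    ∃ b ∈ expSpan K 𝒦, of 1 f * of a (chi K ν) = of b (chi K ν) := by
  induction ha using Submodule.span_induction with
  | mem x hx =>
    obtain ⟨k, hk, rfl⟩ := hx
    exact ⟨_, Submodule.smul_mem _ _ (basis_mem_expSpan hk),
      (one_of_mul_basis f k ν).trans (smul_of ..).symm⟩
  | zero => exact ⟨0, zero_mem _, by rw [zero_of, mul_zero]⟩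
  | add x y _ _ hx hy =>
    obtain ⟨b, hb, h⟩ := hx
    obtain ⟨b', hb', h'⟩ := hy
    exact ⟨b + b', add_mem hb hb', by rw [add_of, mul_add, h, h', add_of]⟩
  | smul c x _ hx =>
    obtain ⟨b, hb, h⟩ := hx
    exact ⟨c • b, Submodule.smul_mem _ _ hb, by rw [smul_of, mul_smul_comm, h, smul_of]⟩

/-- Evaluation of the second factor at a point. -/
noncomputable def ev (K : Type u) [Field K] {n : ℕ} (ν : Fin n → ℤ) : CAlg K n →ₗ[K] KostantAlg K n :=
  (TensorProduct.rid K (KostantAlg K n)).toLinearMap ∘ₗ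
    LinearMap.lTensor (KostantAlg K n) (LinearMap.proj ν)

lemma ev_of (ν : Fin n → ℤ) (a : KostantAlg K n) (f : (Fin n → ℤ) → K) :
    ev K ν (of a f) = f ν • a := rfl

lemma ev_of_chi (ν : Fin n → ℤ) (a : KostantAlg K n) : ev K ν (of a (chi K ν)) = a := by
  rw [ev_of, chi, Pi.single_eq_same, one_smul]

lemma of_chi_injective (ν : Fin n → ℤ) :
    Function.Injective fun a : KostantAlg K n => of a (chi K ν) :=
  Function.LeftInverse.injective (ev_of_chi ν)

/-- The left ideal of the elements `a χ_ν` with `a` in the span of the exponents in `𝒦`. -/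
noncomputable def leftIdeal {𝒦 : Set (PosRoot n → ℕ)} (h𝒦 : IsLeftClosed K 𝒦) (ν : Fin n → ℤ) :
    Submodule (CAlg K n) (CAlg K n) where
  carrier := {x | ∃ a ∈ expSpan K 𝒦, x = of a (chi K ν)}
  zero_mem' := ⟨0, zero_mem _, (zero_of _).symm⟩
  add_mem' := by
    rintro _ _ ⟨a, ha, rfl⟩ ⟨b, hb, rfl⟩
    exact ⟨a + b, add_mem ha hb, (add_of ..).symm⟩
  smul_mem' := by
    rintro r _ ⟨a, ha, rfl⟩
    induction r using of_induction with
    | h0 => exact ⟨0, zero_mem _, by rw [zero_smul, zero_of]⟩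
    | ht b f =>
      obtain ⟨a', ha', h⟩ := one_of_mul_of_chi f ha ν
      exact ⟨b * a', h𝒦 b a' ha', by
        rw [smul_eq_mul, of_eq_mul b f, mul_assoc, h, of_one_mul_of]⟩
    | hadd x y hx hy =>
      obtain ⟨b, hb, h⟩ := hx
      obtain ⟨c, hc, h'⟩ := hy
      exact ⟨b + c, add_mem hb hc, by rw [add_smul, h, h', add_of]⟩

lemma mem_leftIdeal {𝒦 : Set (PosRoot n → ℕ)} (h𝒦 : IsLeftClosed K 𝒦) (ν : Fin n → ℤ)
    {x : CAlg K n} : x ∈ leftIdeal h𝒦 ν ↔ ∃ a ∈ expSpan K 𝒦, x = of a (chi K ν) := Iff.rfl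

/-- The element `∑ c_k y_k` for the ordered products `c_k` in columns `> m`. -/
noncomputable def highSum (K : Type u) [Field K] {n : ℕ} (m : Fin n) {N : Type*} [AddCommGroup N]
    [Module (CAlg K n) N] (g : High m →₀ N) : N :=
  g.sum fun c y => of (basis K n c.1) 1 • y

section highSum

variable {m : Fin n} {N N' : Type*} [AddCommGroup N] [Module (CAlg K n) N] [AddCommGroup N']
  [Module (CAlg K n) N']

lemma highSum_zero : highSum K m (0 : High m →₀ N) = 0 := Finsupp.sum_zero_index

lemma highSum_add (g g' : High m →₀ N) : highSum K m (g + g') = highSum K m g + highSum K m g' :=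
  Finsupp.sum_add_index' (fun _ => smul_zero _) (fun _ _ _ => smul_add _ _ _)

lemma highSum_mapRange (π : N →ₗ[CAlg K n] N') (g : High m →₀ N) :
    highSum K m (g.mapRange π (map_zero π)) = π (highSum K m g) := by
  rw [highSum, Finsupp.sum_mapRange_index (fun _ => smul_zero _), highSum, Finsupp.sum, Finsupp.sum,
    map_sum]
  simp only [map_smul]

lemma exists_mapRange_subtype {α R N : Type*} [Ring R] [AddCommGroup N] [Module R N]
    (S : Submodule R N) (g : α →₀ N) (hg : ∀ c, g c ∈ S) :
    ∃ g' : α →₀ S, g'.mapRange S.subtype (map_zero _) = g := by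
  refine ⟨⟨g.support, fun c => ⟨g c, hg c⟩, fun c => ?_⟩, ?_⟩
  · rw [Finsupp.mem_support_iff, Ne, Ne, Submodule.mk_eq_zero]
  · ext c; rfl

end highSum

/-- The `ℭ_n(K)`-module `N` is induced from a subgroup `M`, stable under the part of `ℭ_n(K)` in
columns `≤ m`, all of whose weights have negative coordinate `m`. -/
structure IsInduced (K : Type u) [Field K] {n : ℕ} (m : Fin n) {N : Type*} [AddCommGroup N]
    [Module (CAlg K n) N] (M : AddSubgroup N) : Prop where
  smul_mem : ∀ a ∈ expSpan K (Low m), ∀ x ∈ M, of a 1 • x ∈ M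
  fun_smul_mem : ∀ (f : (Fin n → ℤ) → K), ∀ x ∈ M, of (1 : KostantAlg K n) f • x ∈ M
  weight : ∀ x ∈ M, ∃ s : Finset (Fin n → ℤ), (∀ ν ∈ s, ν m < 0) ∧
    of (1 : KostantAlg K n) ((s : Set (Fin n → ℤ)).indicator 1) • x = x
  surj : ∀ x : N, ∃ g : High m →₀ N, (∀ c, g c ∈ M) ∧
    x = highSum K m g
  inj : ∀ g : High m →₀ N, (∀ c, g c ∈ M) → highSum K m g = 0 → g = 0

lemma indicator_smul_of_subset {N : Type*} [AddCommGroup N] [Module (CAlg K n) N]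
    {s t : Finset (Fin n → ℤ)} (hst : s ⊆ t) {x : N}
    (h : of (1 : KostantAlg K n) ((s : Set (Fin n → ℤ)).indicator 1) • x = x) :
    of (1 : KostantAlg K n) ((t : Set (Fin n → ℤ)).indicator 1) • x = x := by
  have h1 : (t : Set (Fin n → ℤ)).indicator (1 : (Fin n → ℤ) → K) *
      (s : Set (Fin n → ℤ)).indicator 1 = (s : Set (Fin n → ℤ)).indicator 1 := by
    funext z
    by_cases hz : z ∈ s
    · simp [hz, hst hz]
    · simp [hz]
  rw [← h, smul_smul, of_mul_one_of, h1]

namespace IsInduced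

variable {m : Fin n}

lemma directSum {W : Type*} [DecidableEq W] {N : W → Type*} [∀ w, AddCommGroup (N w)]
    [∀ w, Module (CAlg K n) (N w)] {M : ∀ w, AddSubgroup (N w)} (h : ∀ w, IsInduced K m (M w)) :
    IsInduced K m (N := ⨁ w, N w)
      { carrier := {f | ∀ w, f w ∈ M w}
        zero_mem' := fun w => zero_mem (M w)
        add_mem' := fun ha hb w => add_mem (ha w) (hb w)
        neg_mem' := fun ha w => neg_mem (ha w) } where
  smul_mem a ha x hx w := (h w).smul_mem a ha _ (hx w)
  fun_smul_mem f x hx w := (h w).fun_smul_mem f _ (hx w)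
  weight x hx := by
    classical
    choose s hs hsx using fun w => (h w).weight (x w) (hx w)
    -- Enlarging the finite set of weights does not disturb a vector already fixed, so the union
    -- over the support serves all components.
    refine ⟨(DFinsupp.support x).biUnion s, fun ν hν => ?_, ?_⟩
    · obtain ⟨w, _, hw⟩ := Finset.mem_biUnion.mp hν
      exact hs w ν hw
    · refine DFinsupp.ext fun w => ?_
      rw [DirectSum.smul_apply]
      by_cases hw : w ∈ DFinsupp.support x
      · exact indicator_smul_of_subset (Finset.subset_biUnion_of_mem s hw) (hsx w)
      · rw [DFinsupp.notMem_support_iff.mp hw, smul_zero]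
  surj x := by
    induction x using DirectSum.induction_on with
    | zero => exact ⟨0, fun c w => zero_mem _, highSum_zero.symm⟩
    | of w y =>
      obtain ⟨g, hg, rfl⟩ := (h w).surj y
      refine ⟨g.mapRange (DirectSum.lof (CAlg K n) W N w) (map_zero _), fun c w' => ?_,
        (highSum_mapRange (DirectSum.lof (CAlg K n) W N w) g).symm⟩
      rw [Finsupp.mapRange_apply]
      by_cases hw : w = w'
      · subst hw
        rw [DirectSum.lof_apply]
        exact hg c
      · rw [DirectSum.lof_eq_of, DirectSum.of_eq_of_ne _ _ _ (Ne.symm hw)]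
        exact zero_mem _
    | add x y hx hy =>
      obtain ⟨g, hg, rfl⟩ := hx
      obtain ⟨g', hg', rfl⟩ := hy
      exact ⟨g + g', fun c w => add_mem (hg c w) (hg' c w), (highSum_add _ _).symm⟩
  inj g hg h0 := by
    ext c w
    have h1 := (h w).inj (g.mapRange (DirectSum.component (CAlg K n) W N w) (map_zero _))
      (fun c => hg c w) (by rw [highSum_mapRange, h0, map_zero])
    exact DFunLike.congr_fun h1 c

/-- Coordinates along high monomials are unique and carried along by `π`, so an element of the
kernel has all its coordinates in the kernel. -/
lemma ker {N F : Type*} [AddCommGroup N] [Module (CAlg K n) N] [AddCommGroup F]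
    [Module (CAlg K n) F] {M : AddSubgroup N} {L : AddSubgroup F} (hN : IsInduced K m M)
    (hF : IsInduced K m L) (π : F →ₗ[CAlg K n] N) (hπ : ∀ x ∈ L, π x ∈ M) :
    IsInduced K m (L.comap (LinearMap.ker π).subtype.toAddMonoidHom) where
  smul_mem a ha x hx := hF.smul_mem a ha _ hx
  fun_smul_mem f x hx := hF.fun_smul_mem f _ hx
  weight x hx := by
    obtain ⟨s, hs, h⟩ := hF.weight _ hx
    exact ⟨s, hs, Subtype.ext h⟩
  surj x := by
    obtain ⟨g, hg, hx⟩ := hF.surj x.1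
    have h1 := hN.inj (g.mapRange π (map_zero _)) (fun c => hπ _ (hg c)) (by
      rw [highSum_mapRange, ← hx]
      exact x.2)
    obtain ⟨g', rfl⟩ := exists_mapRange_subtype (LinearMap.ker π) g
      fun c => DFunLike.congr_fun h1 c
    exact ⟨g', hg, Subtype.ext (hx.trans (highSum_mapRange _ _))⟩
  inj g hg h0 := by
    have h1 := hF.inj (g.mapRange (LinearMap.ker π).subtype (map_zero _)) hg (by
      rw [highSum_mapRange, h0, map_zero])
    exact Finsupp.mapRange_injective _ (map_zero _) (LinearMap.ker π).injective_subtype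
      (h1.trans (Finsupp.mapRange_zero ..).symm)

end IsInduced

lemma exists_indicator_mul_of_chi {m : Fin n} {𝒦 : Set (PosRoot n → ℕ)} {ν : Fin n → ℤ}
    (h𝒦 : ∀ k ∈ 𝒦, (expDeg k : Fin n → ℤ) m + ν m < 0) {a : KostantAlg K n}
    (ha : a ∈ expSpan K 𝒦) : ∃ s : Finset (Fin n → ℤ), (∀ ν ∈ s, ν m < 0) ∧
      of (1 : KostantAlg K n) ((s : Set (Fin n → ℤ)).indicator 1) • of a (chi K ν) =
        of a (chi K ν) := by
  classical
  induction ha using Submodule.span_induction with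
  | mem x hx =>
    obtain ⟨k, hk, rfl⟩ := hx
    refine ⟨{(expDeg k : Fin n → ℤ) + ν}, by simpa using h𝒦 k hk, ?_⟩
    rw [smul_eq_mul, one_of_mul_basis]
    simp
  | zero => exact ⟨∅, by simp, by rw [zero_of, smul_zero]⟩
  | add x y _ _ hx hy =>
    obtain ⟨s, hs, h⟩ := hx
    obtain ⟨t, ht, h'⟩ := hy
    refine ⟨s ∪ t, fun ν hν => ?_, ?_⟩
    · rcases Finset.mem_union.mp hν with hν | hν
      · exact hs ν hν
      · exact ht ν hν
    · rw [add_of, smul_add, indicator_smul_of_subset Finset.subset_union_left h,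
        indicator_smul_of_subset Finset.subset_union_right h']
  | smul c x _ hx =>
    obtain ⟨s, hs, h⟩ := hx
    refine ⟨s, hs, ?_⟩
    rw [smul_of, smul_eq_mul, mul_smul_comm, ← smul_eq_mul, h]

/-- The elements `a χ_ν` with `a` in the span of the exponents in `𝒦` supported in columns
`≤ m`. -/
noncomputable def lowSubgroup {𝒦 : Set (PosRoot n → ℕ)} (h𝒦 : IsLeftClosed K 𝒦) (ν : Fin n → ℤ)
    (m : Fin n) : AddSubgroup (leftIdeal h𝒦 ν) where
  carrier := {x | ∃ a ∈ expSpan K (𝒦 ∩ Low m), x.1 = of a (chi K ν)}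
  zero_mem' := ⟨0, zero_mem _, (zero_of _).symm⟩
  add_mem' := by
    rintro x y ⟨a, ha, h⟩ ⟨b, hb, h'⟩
    exact ⟨a + b, add_mem ha hb, by rw [add_of, ← h, ← h', Submodule.coe_add]⟩
  neg_mem' := by
    rintro x ⟨a, ha, h⟩
    exact ⟨(-1 : K) • a, Submodule.smul_mem _ _ ha, by
      rw [smul_of, ← h, neg_one_smul, Submodule.coe_neg]⟩

lemma mem_lowSubgroup {𝒦 : Set (PosRoot n → ℕ)} {h𝒦 : IsLeftClosed K 𝒦} {ν : Fin n → ℤ}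
    {m : Fin n} {x : leftIdeal h𝒦 ν} :
    x ∈ lowSubgroup h𝒦 ν m ↔ ∃ a ∈ expSpan K (𝒦 ∩ Low m), x.1 = of a (chi K ν) := Iff.rfl

/-- The embedding `a ↦ a χ_ν`. -/
noncomputable def ofChi (K : Type u) [Field K] {n : ℕ} (ν : Fin n → ℤ) :
    KostantAlg K n →+ CAlg K n where
  toFun a := of a (chi K ν)
  map_zero' := zero_of _
  map_add' _ _ := add_of ..

lemma highSum_mapRange_ofChi {m : Fin n} (ν : Fin n → ℤ) (g : High m →₀ KostantAlg K n) :
    highSum K m (g.mapRange (ofChi K ν) (map_zero _)) =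
      ofChi K ν (g.sum fun c y => basis K n c.1 * y) := by
  rw [highSum, Finsupp.sum_mapRange_index (fun _ => smul_zero _), Finsupp.sum, Finsupp.sum, map_sum]
  exact Finset.sum_congr rfl fun c _ => of_one_mul_of ..

variable {m : Fin n} {𝒦 : Set (PosRoot n → ℕ)} (h𝒦 : IsLeftClosed K 𝒦) {ν : Fin n → ℤ}

lemma smul_mem_lowSubgroup : ∀ a ∈ expSpan K (Low m), ∀ x ∈ lowSubgroup h𝒦 ν m,
    of a 1 • x ∈ lowSubgroup h𝒦 ν m := by
  intro a ha x hx
  rw [mem_lowSubgroup] at hx ⊢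
  obtain ⟨b, hb, h⟩ := hx
  refine ⟨a * b, ?_, ?_⟩
  · rw [expSpan_inter] at *
    exact ⟨h𝒦 a b hb.1, mul_mem_expSpan_low ha hb.2⟩
  · rw [← of_one_mul_of, ← h, Submodule.coe_smul, smul_eq_mul]

lemma fun_smul_mem_lowSubgroup : ∀ (f : (Fin n → ℤ) → K), ∀ x ∈ lowSubgroup h𝒦 ν m,
    of (1 : KostantAlg K n) f • x ∈ lowSubgroup h𝒦 ν m := by
  intro f x hx
  rw [mem_lowSubgroup] at hx ⊢
  obtain ⟨b, hb, h⟩ := hx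
  obtain ⟨b', hb', h'⟩ := one_of_mul_of_chi f hb ν
  exact ⟨b', hb', by rw [← h', ← h, Submodule.coe_smul, smul_eq_mul]⟩

lemma exists_indicator_smul_lowSubgroup (hν : ∀ k ∈ 𝒦, ν m < colSum m k) :
    ∀ x ∈ lowSubgroup h𝒦 ν m, ∃ s : Finset (Fin n → ℤ), (∀ ν ∈ s, ν m < 0) ∧
      of (1 : KostantAlg K n) ((s : Set (Fin n → ℤ)).indicator 1) • x = x := by
  intro x hx
  obtain ⟨b, hb, h⟩ := mem_lowSubgroup.mp hx
  obtain ⟨s, hs, h'⟩ := exists_indicator_mul_of_chi (m := m) (ν := ν) (fun k hk => by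
    rw [coe_expDeg_of_mem_low hk.2]
    have := hν k hk.1
    omega) hb
  exact ⟨s, hs, Subtype.ext (by rw [← h] at h'; exact h')⟩

lemma exists_highSum_leftIdeal (hlow : ∀ k ∈ 𝒦, lowPart m k ∈ 𝒦) :
    ∀ x : leftIdeal h𝒦 ν, ∃ g : High m →₀ leftIdeal h𝒦 ν, (∀ c, g c ∈ lowSubgroup h𝒦 ν m) ∧
      x = highSum K m g := by
  intro x
  obtain ⟨a, ha, hx⟩ := (mem_leftIdeal h𝒦 ν).mp x.2
  obtain ⟨g, hg, h⟩ := exists_sum_high m hlow ha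
  have hmem : ∀ c, g.mapRange (ofChi K ν) (map_zero _) c ∈ leftIdeal h𝒦 ν := fun c =>
    (mem_leftIdeal h𝒦 ν).mpr ⟨g c, expSpan_mono Set.inter_subset_left (hg c), rfl⟩
  obtain ⟨g', hg'⟩ := exists_mapRange_subtype _ _ hmem
  refine ⟨g', fun c => mem_lowSubgroup.mpr ⟨g c, hg c, DFunLike.congr_fun hg' c⟩,
    Subtype.ext ?_⟩
  have h1 := highSum_mapRange (m := m) (leftIdeal h𝒦 ν).subtype g'
  rw [hg', highSum_mapRange_ofChi, ← h] at h1
  exact hx.trans h1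

lemma eq_zero_of_highSum_leftIdeal : ∀ g : High m →₀ leftIdeal h𝒦 ν,
    (∀ c, g c ∈ lowSubgroup h𝒦 ν m) → highSum K m g = 0 → g = 0 := by
  intro g hg h0
  let G : High m →₀ KostantAlg K n := g.mapRange (fun x => ev K ν x.1) (map_zero (ev K ν))
  have hG : ∀ c, G c ∈ expSpan K (Low m) ∧ (g c).1 = ofChi K ν (G c) := by
    intro c
    obtain ⟨a, ha, h⟩ := mem_lowSubgroup.mp (hg c)
    have h1 : G c = a := by rw [← ev_of_chi ν a, ← h]; rfl
    rw [h1]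
    exact ⟨expSpan_mono Set.inter_subset_right ha, h⟩
  have h1 : g.mapRange (leftIdeal h𝒦 ν).subtype (map_zero _) =
      G.mapRange (ofChi K ν) (map_zero _) := Finsupp.ext fun c => (hG c).2
  have h2 := highSum_mapRange (m := m) (leftIdeal h𝒦 ν).subtype g
  rw [h1, h0, map_zero, highSum_mapRange_ofChi] at h2
  have h3 : G = 0 := eq_zero_of_sum_high_eq_zero (fun c => (hG c).1)
    (of_chi_injective ν (h2.trans (zero_of _).symm))
  refine Finsupp.ext fun c => Subtype.ext ?_
  rw [(hG c).2, h3]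
  exact map_zero _

/-- `hlow` lets every element be expanded with low coordinates inside the same ideal; `hν` makes `ν
m - colSum m k`, the coordinate `m` of each low weight, negative. -/
lemma isInduced_leftIdeal (hlow : ∀ k ∈ 𝒦, lowPart m k ∈ 𝒦) (hν : ∀ k ∈ 𝒦, ν m < colSum m k) :
    IsInduced K m (lowSubgroup h𝒦 ν m) :=
  ⟨smul_mem_lowSubgroup h𝒦, fun_smul_mem_lowSubgroup h𝒦,
    exists_indicator_smul_lowSubgroup h𝒦 hν, exists_highSum_leftIdeal h𝒦 hlow,
    eq_zero_of_highSum_leftIdeal h𝒦⟩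

end CAlg

/-! ### Left ideals generated by an idempotent. -/

section IdempotentIdeal

variable {R : Type u} [Ring R] {ε : R}

/-- Right multiplication by `ε` splits the inclusion into `R`. -/
lemma projective_span_idempotent (hε : IsIdempotentElem ε) :
    Module.Projective R (Submodule.span R {ε}) := by
  refine Module.Projective.of_split (Submodule.span R {ε}).subtype
    ((LinearMap.toSpanSingleton R R ε).codRestrict _ fun r =>
      Submodule.smul_mem _ r (Submodule.mem_span_singleton_self ε)) ?_
  ext x
  obtain ⟨r, hr⟩ := Submodule.mem_span_singleton.mp x.2
  change x.1 * ε = x.1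
  rw [← hr, smul_eq_mul, mul_assoc, hε.eq]

/-- The generator satisfies `ε = ε • ε`, so its image lies in `ε • Y = 0`. -/
lemma map_span_idempotent_eq_zero (hε : IsIdempotentElem ε) {Y : Type*} [AddCommGroup Y]
    [Module R Y] (hY : ∀ y : Y, ε • y = 0) (f : Submodule.span R {ε} →ₗ[R] Y) : f = 0 := by
  ext x
  obtain ⟨r, hr⟩ := Submodule.mem_span_singleton.mp x.2
  let y : Submodule.span R {ε} := ⟨ε, Submodule.mem_span_singleton_self ε⟩
  have hy : y = ε • y := Subtype.ext hε.eq.symm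
  have hx : x = r • y := Subtype.ext hr.symm
  rw [hx, hy, map_smul, map_smul, hY, smul_zero, LinearMap.zero_apply]

lemma extOrthogonal_span_idempotent {I : Ideal R} (hε : IsIdempotentElem ε) (h : ε ∈ I) :
    ExtOrthogonal.{u} (KilledBy I) (ModuleCat.of R (Submodule.span R {ε})) := by
  intro Y hY n x
  have := projective_span_idempotent hε
  cases n with
  | zero =>
    obtain ⟨φ, rfl⟩ := (Abelian.Ext.mk₀_bijective _ _).2 x
    have h1 : φ = 0 := ModuleCat.hom_ext (map_span_idempotent_eq_zero hε (hY ε h) φ.hom)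
    rw [h1, Abelian.Ext.mk₀_zero]
  | succ n =>
    have : Projective (ModuleCat.of R (Submodule.span R {ε})) :=
      ModuleCat.projective_of_categoryTheory_projective _
    exact Abelian.Ext.eq_zero_of_projective x

end IdempotentIdeal

/-! ### Resolutions of induced modules. -/

namespace CAlg

variable {K : Type u} [Field K] {n : ℕ}

open PosRoot KostantAlg

lemma isIdempotentElem_chi (ν : Fin n → ℤ) :
    IsIdempotentElem (of (1 : KostantAlg K n) (chi K ν)) := by
  rw [IsIdempotentElem, of_mul_one_of, mul_chi, chi, Pi.single_eq_same, one_smul]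

lemma leftIdeal_univ (ν : Fin n → ℤ) : leftIdeal (isLeftClosed_univ (K := K)) ν =
    Submodule.span (CAlg K n) {of (1 : KostantAlg K n) (chi K ν)} := by
  refine le_antisymm ?_ ?_
  · rintro _ ⟨a, _, rfl⟩
    have h := Submodule.smul_mem (Submodule.span (CAlg K n) {of (1 : KostantAlg K n) (chi K ν)})
      (of a 1) (Submodule.mem_span_singleton_self _)
    rwa [smul_eq_mul, ← of_eq_mul] at h
  · rw [Submodule.span_singleton_le_iff_mem]
    exact ⟨1, by rw [expSpan_univ]; trivial, rfl⟩

section Syzygy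

variable {m : Fin n} {N : Type u} [AddCommGroup N] [Module (CAlg K n) N]

/-- The weight vectors in `M` whose weight has negative coordinate `m`. -/
def WeightVector (K : Type u) [Field K] {n : ℕ} (m : Fin n) {N : Type u} [AddCommGroup N]
    [Module (CAlg K n) N] (M : AddSubgroup N) : Type u :=
  {w : N × (Fin n → ℤ) // w.1 ∈ M ∧ of (1 : KostantAlg K n) (chi K w.2) • w.1 = w.1 ∧ w.2 m < 0}

/-- The projective cover of `N` by the left ideals of weight vectors. -/
noncomputable def weightCover (M : AddSubgroup N) [DecidableEq (WeightVector K m M)] :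
    (⨁ w : WeightVector K m M, leftIdeal (isLeftClosed_univ (K := K)) w.1.2) →ₗ[CAlg K n] N :=
  DirectSum.toModule _ _ _ fun w =>
    (LinearMap.toSpanSingleton (CAlg K n) N w.1.1).comp (Submodule.subtype _)

lemma indicator_eq_sum (s : Finset (Fin n → ℤ)) :
    (s : Set (Fin n → ℤ)).indicator (1 : (Fin n → ℤ) → K) = ∑ ν ∈ s, chi K ν := by
  funext z
  rw [Finset.sum_apply]
  simp only [chi, Pi.single_apply]
  rw [Finset.sum_ite_eq]
  simp [Set.indicator_apply]

lemma of_sum (a : KostantAlg K n) {ι : Type*} (s : Finset ι) (f : ι → (Fin n → ℤ) → K) :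
    of a (∑ i ∈ s, f i) = ∑ i ∈ s, of a (f i) := TensorProduct.tmul_sum ..

variable {M : AddSubgroup N}

/-- A vector of `M` is the finite sum of its weight components; these stay in `M` by stability under
functions, so they are among the generators of the cover. -/
lemma IsInduced.exists_weightCover_eq [DecidableEq (WeightVector K m M)] (hM : IsInduced K m M)
    {x : N} (hx : x ∈ M) : ∃ y, weightCover (K := K) (m := m) M y = x := by
  obtain ⟨s, hs, h⟩ := hM.weight x hx
  rw [indicator_eq_sum, of_sum, Finset.sum_smul] at h
  change x ∈ LinearMap.range (weightCover (K := K) (m := m) M)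
  rw [← h]
  refine sum_mem fun ν hν => ?_
  let w : WeightVector K m M := ⟨(of (1 : KostantAlg K n) (chi K ν) • x, ν),
    hM.fun_smul_mem _ x hx, by
      simp only
      rw [smul_smul, (isIdempotentElem_chi ν).eq], hs ν hν⟩
  refine ⟨DirectSum.lof (CAlg K n) _ _ w ⟨of 1 (chi K ν), 1, by rw [expSpan_univ]; trivial, rfl⟩, ?_⟩
  rw [weightCover, DirectSum.toModule_lof]
  exact w.2.2.1

lemma IsInduced.weightCover_surjective [DecidableEq (WeightVector K m M)] (hM : IsInduced K m M) :
    Function.Surjective (weightCover (K := K) (m := m) M) := by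
  intro x
  obtain ⟨g, hg, rfl⟩ := hM.surj x
  change _ ∈ LinearMap.range (weightCover (K := K) (m := m) M)
  refine sum_mem fun c _ => Submodule.smul_mem _ _ ?_
  exact hM.exists_weightCover_eq (hg c)

/-- The compatibility of the inducing subgroups that `IsInduced.ker` requires. -/
lemma IsInduced.weightCover_mem [DecidableEq (WeightVector K m M)] (hM : IsInduced K m M)
    (x : ⨁ w : WeightVector K m M, leftIdeal (isLeftClosed_univ (K := K)) w.1.2)
    (hx : ∀ w, x w ∈ lowSubgroup (isLeftClosed_univ (K := K)) w.1.2 m) :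
    weightCover (K := K) (m := m) M x ∈ M := by
  classical
  have h1 : x = ∑ w ∈ DFinsupp.support x, DirectSum.lof (CAlg K n) _ _ w (x w) :=
    (DirectSum.sum_support_of x).symm
  rw [h1, map_sum]
  refine sum_mem fun w _ => ?_
  obtain ⟨a, ha, h⟩ := mem_lowSubgroup.mp (hx w)
  rw [Set.univ_inter] at ha
  rw [weightCover, DirectSum.toModule_lof]
  change (x w).1 • w.1.1 ∈ M
  rw [h, of_eq_mul, mul_smul, w.2.2.1]
  exact hM.smul_mem a ha _ w.2.1

/-- The cover is a sum of projectives generated by idempotents `χ_ν` of `I`, hence has no maps to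
modules killed by `I`. Cover and quotient are both induced, hence so is the kernel. -/
lemma IsInduced.exists_syzygy {I : Ideal (CAlg K n)}
    (hI : ∀ ν : Fin n → ℤ, ν m < 0 → of (1 : KostantAlg K n) (chi K ν) ∈ I)
    (N : ModuleCat.{u} (CAlg K n)) (hN : ∃ M : AddSubgroup N, IsInduced K m M) :
    ∃ S : ShortComplex (ModuleCat.{u} (CAlg K n)), S.ShortExact ∧ S.X₃ = N ∧ Projective S.X₂ ∧
      (∀ Y, KilledBy I Y → ∀ f : S.X₂ ⟶ Y, f = 0) ∧ ∃ M : AddSubgroup S.X₁, IsInduced K m M := by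
  classical
  obtain ⟨M, hM⟩ := hN
  let π := weightCover (K := K) (m := m) M
  have hP : ∀ w : WeightVector K m M,
      Module.Projective (CAlg K n) (leftIdeal (isLeftClosed_univ (K := K)) w.1.2) := by
    intro w
    rw [leftIdeal_univ]
    exact projective_span_idempotent (isIdempotentElem_chi _)
  refine ⟨π.shortComplexKer, LinearMap.shortExact_shortComplexKer hM.weightCover_surjective, rfl,
    ModuleCat.projective_of_categoryTheory_projective _, fun Y hY f => ?_, ?_⟩
  · refine ModuleCat.hom_ext (DirectSum.linearMap_ext _ fun w => ?_)
    have key : ∀ f : leftIdeal (isLeftClosed_univ (K := K)) w.1.2 →ₗ[CAlg K n] Y, f = 0 := by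
      rw [leftIdeal_univ]
      exact map_span_idempotent_eq_zero (isIdempotentElem_chi _) (hY _ (hI _ w.2.2.2))
    exact (key _).trans (LinearMap.zero_comp _).symm
  -- Lowering a weight at `m` by a column sum keeps it negative, so each summand of the cover is
  -- induced.
  · have hL := IsInduced.directSum (K := K) (m := m) fun w : WeightVector K m M =>
      isInduced_leftIdeal (isLeftClosed_univ (K := K)) (ν := w.1.2)
        (fun _ _ => trivial) fun k _ => w.2.2.2.trans_le (Int.natCast_nonneg _)
    exact ⟨_, hM.ker hL π fun x hx => hM.weightCover_mem x hx⟩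

lemma IsInduced.extOrthogonal {I : Ideal (CAlg K n)}
    (hI : ∀ ν : Fin n → ℤ, ν m < 0 → of (1 : KostantAlg K n) (chi K ν) ∈ I)
    (hM : IsInduced K m M) :
    ExtOrthogonal.{u} (KilledBy I) (ModuleCat.of (CAlg K n) N) :=
  ExtOrthogonal.of_syzygy (fun N : ModuleCat.{u} (CAlg K n) => ∃ M : AddSubgroup N, IsInduced K m M)
    (fun N hN => IsInduced.exists_syzygy hI N hN) ⟨M, hM⟩

end Syzygy

/-! ### Orthogonality of the left ideals of bad exponents. -/

/-- The exponents with too large a sum in some column `j < t`. -/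
def Bad (t : ℕ) (μ : Fin n → ℤ) : Set (PosRoot n → ℕ) :=
  {k | ∃ j : Fin n, j.1 < t ∧ μ j < colSum j k}

lemma bad_zero (μ : Fin n → ℤ) : Bad 0 μ = ∅ := by
  ext k
  simp [Bad]

lemma bad_succ {t : ℕ} (ht : t < n) (μ : Fin n → ℤ) :
    Bad (t + 1) μ = Bad t μ ∪ {k | μ ⟨t, ht⟩ < colSum ⟨t, ht⟩ k} := by
  ext k
  constructor
  · rintro ⟨j, hj, h⟩
    rcases Nat.lt_succ_iff_lt_or_eq.mp hj with h' | h'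
    · exact Or.inl ⟨j, h', h⟩
    · subst h'
      exact Or.inr h
  · rintro (⟨j, hj, h⟩ | h)
    · exact ⟨j, hj.trans (Nat.lt_succ_self t), h⟩
    · exact ⟨⟨t, ht⟩, Nat.lt_succ_self t, h⟩

lemma isLeftClosed_bad {t : ℕ} (ht : t ≤ n) (μ : Fin n → ℤ) : IsLeftClosed K (Bad t μ) := by
  induction t with
  | zero => rw [bad_zero]; exact isLeftClosed_empty
  | succ t ih =>
    rw [bad_succ ht]
    exact (ih (Nat.le_of_succ_le ht)).union (isLeftClosed_colSum _ _)

lemma leftIdeal_union {𝒦 ℒ : Set (PosRoot n → ℕ)} (h : IsLeftClosed K 𝒦) (h' : IsLeftClosed K ℒ)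
    (μ : Fin n → ℤ) : leftIdeal (h.union h') μ = leftIdeal h μ ⊔ leftIdeal h' μ := by
  refine le_antisymm ?_ (sup_le ?_ ?_)
  · rintro _ ⟨a, ha, rfl⟩
    rw [expSpan_union] at ha
    obtain ⟨b, hb, c, hc, rfl⟩ := Submodule.mem_sup.mp ha
    rw [add_of]
    exact add_mem (Submodule.mem_sup_left ⟨b, hb, rfl⟩) (Submodule.mem_sup_right ⟨c, hc, rfl⟩)
  · rintro _ ⟨a, ha, rfl⟩
    exact ⟨a, expSpan_mono Set.subset_union_left ha, rfl⟩
  · rintro _ ⟨a, ha, rfl⟩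
    exact ⟨a, expSpan_mono Set.subset_union_right ha, rfl⟩

lemma leftIdeal_inter {𝒦 ℒ : Set (PosRoot n → ℕ)} (h : IsLeftClosed K 𝒦) (h' : IsLeftClosed K ℒ)
    (μ : Fin n → ℤ) : leftIdeal (h.inter h') μ = leftIdeal h μ ⊓ leftIdeal h' μ := by
  refine le_antisymm (le_inf ?_ ?_) ?_
  · rintro _ ⟨a, ha, rfl⟩
    exact ⟨a, expSpan_mono Set.inter_subset_left ha, rfl⟩
  · rintro _ ⟨a, ha, rfl⟩
    exact ⟨a, expSpan_mono Set.inter_subset_right ha, rfl⟩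
  · rintro x ⟨⟨a, ha, hx⟩, ⟨b, hb, hx'⟩⟩
    obtain rfl : a = b := of_chi_injective μ (hx.symm.trans hx')
    exact ⟨a, by rw [expSpan_inter]; exact ⟨ha, hb⟩, hx⟩

lemma extOrthogonal_leftIdeal_bad {I : Ideal (CAlg K n)}
    (hI : ∀ (m : Fin n) (ν : Fin n → ℤ), ν m < 0 → of (1 : KostantAlg K n) (chi K ν) ∈ I)
    {t : ℕ} (ht : t ≤ n) (μ : Fin n → ℤ) : ExtOrthogonal.{u} (KilledBy I)
      (ModuleCat.of (CAlg K n) (leftIdeal (isLeftClosed_bad (K := K) ht μ) μ)) := by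
  induction t with
  | zero =>
    have h : leftIdeal (isLeftClosed_bad (K := K) ht μ) μ = ⊥ := by
      rw [eq_bot_iff]
      rintro _ ⟨a, ha, rfl⟩
      rw [bad_zero, expSpan, Set.image_empty, Submodule.span_empty, Submodule.mem_bot] at ha
      rw [ha, zero_of]
      exact zero_mem _
    rw [h]
    exact ExtOrthogonal.bot
  | succ t ih =>
    have ht' : t ≤ n := Nat.le_of_succ_le ht
    have hB := isLeftClosed_bad (K := K) ht' μ
    have hC := isLeftClosed_colSum (K := K) ⟨t, ht⟩ (μ ⟨t, ht⟩)
    have h : leftIdeal (isLeftClosed_bad (K := K) ht μ) μ = leftIdeal hB μ ⊔ leftIdeal hC μ := by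
      rw [← leftIdeal_union]
      congr 1
      exact bad_succ ht μ
    have hlow : ∀ k : PosRoot n → ℕ, μ ⟨t, ht⟩ < colSum ⟨t, ht⟩ k →
        μ ⟨t, ht⟩ < colSum ⟨t, ht⟩ (lowPart ⟨t, ht⟩ k) := fun k hk => by
      rwa [colSum_lowPart le_rfl]
    rw [h]
    refine ExtOrthogonal.sup (ih ht') ?_ ?_
    · exact (isInduced_leftIdeal hC (m := ⟨t, ht⟩) hlow fun k hk => hk).extOrthogonal (hI _)
    -- Columns are added in increasing order: the conditions on columns `j < t` survive truncation
    -- to columns `≤ t`, so the intersection is still induced from those columns.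
    · rw [← leftIdeal_inter]
      refine (isInduced_leftIdeal (hB.inter hC) (m := ⟨t, ht⟩) ?_ fun k hk => hk.2).extOrthogonal
        (hI _)
      rintro k ⟨⟨j, hj, hk⟩, hk'⟩
      refine ⟨⟨j, hj, ?_⟩, hlow k hk'⟩
      rwa [colSum_lowPart (Fin.le_def.mpr hj.le)]

end CAlg

/-! ### The ideal generated by `1 - e` and its strong idempotence. -/

namespace CAlg

variable {K : Type u} [Field K] {n r : ℕ}

open PosRoot KostantAlg

lemma sum_expDeg (k : PosRoot n → ℕ) : ∑ i, (expDeg k : Fin n → ℤ) i = 0 := by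
  rw [expDeg_eq_sum, AddSubmonoidClass.coe_finsetSum]
  simp only [Finset.sum_apply]
  rw [Finset.sum_comm]
  refine Finset.sum_eq_zero fun p _ => ?_
  simp [deg, ← Finset.mul_sum, Finset.sum_sub_distrib]

/-- Coordinate `i` of the new weight is the row sum of `k` plus `μ i` minus the column sum, and the
latter difference is nonnegative when `k` is not bad. -/
lemma expDeg_add_mem_compositions {μ : Fin n → ℤ} (hμ : μ ∈ compositions n r) {k : PosRoot n → ℕ}
    (hk : k ∉ Bad n μ) : (expDeg k : Fin n → ℤ) + μ ∈ compositions n r := by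
  constructor
  · intro i
    have h : (colSum i k : ℤ) ≤ μ i := by
      by_contra h
      exact hk ⟨i, i.2, not_le.mp h⟩
    have h' : 0 ≤ ∑ p : PosRoot n, if p.1.1 = i then (k p : ℤ) else 0 :=
      Finset.sum_nonneg fun p _ => by split_ifs <;> simp
    rw [Pi.add_apply, coe_expDeg]
    omega
  · simp only [Pi.add_apply]
    rw [Finset.sum_add_distrib, sum_expDeg, zero_add, hμ.2]

lemma finite_compositions (n r : ℕ) : (compositions n r).Finite := by
  refine (Set.finite_Icc (0 : Fin n → ℤ) (fun _ => (r : ℤ))).subset ?_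
  rintro z ⟨h0, h1⟩
  refine ⟨h0, fun i => ?_⟩
  rw [← h1]
  exact Finset.single_le_sum (fun j _ => h0 j) (Finset.mem_univ i)

lemma ideal_mul_mem {x : CAlg K n} (hx : x ∈ CAlg.ideal K n r) (y : CAlg K n) :
    x * y ∈ CAlg.ideal K n r := Ideal.mul_mem_right y _ hx

lemma one_sub_e_mem : 1 - CAlg.e K n r ∈ CAlg.ideal K n r :=
  TwoSidedIdeal.mem_asIdeal.mpr (TwoSidedIdeal.subset_span rfl)

lemma one_sub_e : (1 - CAlg.e K n r) = of (1 : KostantAlg K n) (1 - (compositions n r).indicator 1) := by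
  rw [one_def, sub_eq_iff_eq_add]
  change _ = _ + of 1 _
  rw [← of_add, sub_add_cancel]

lemma isIdempotentElem_one_sub_e : IsIdempotentElem (1 - CAlg.e K n r) := by
  refine IsIdempotentElem.one_sub ?_
  change of 1 _ * of 1 _ = of 1 _
  rw [of_mul_one_of]
  congr 1
  funext z
  by_cases hz : z ∈ compositions n r <;> simp [hz]

lemma chi_mem_ideal {ν : Fin n → ℤ} (hν : ν ∉ compositions n r) :
    of (1 : KostantAlg K n) (chi K ν) ∈ CAlg.ideal K n r := by
  have h := (CAlg.ideal K n r).mul_mem_left (of (1 : KostantAlg K n) (chi K ν)) one_sub_e_mem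
  rw [one_sub_e, of_mul_one_of, mul_comm, mul_chi] at h
  simpa [hν] using h

lemma smul_mem_ideal (c : K) {x : CAlg K n} (hx : x ∈ CAlg.ideal K n r) :
    c • x ∈ CAlg.ideal K n r := by
  have h := (CAlg.ideal K n r).mul_mem_left (c • 1) hx
  rwa [smul_mul_assoc, one_mul] at h

lemma chi_mem_ideal_of_neg (m : Fin n) (ν : Fin n → ℤ) (hν : ν m < 0) :
    of (1 : KostantAlg K n) (chi K ν) ∈ CAlg.ideal K n r :=
  chi_mem_ideal fun h => absurd (h.1 m) (not_le.mpr hν)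

/-- If column `m` is too large, the low part of the monomial takes `μ` to a weight negative at `m`,
so it factors through an idempotent `χ` in the ideal. -/
lemma of_chi_mem_ideal_of_bad {μ : Fin n → ℤ} {a : KostantAlg K n} (ha : a ∈ expSpan K (Bad n μ)) :
    of a (chi K μ) ∈ CAlg.ideal K n r := by
  induction ha using Submodule.span_induction with
  | mem x hx =>
    obtain ⟨k, ⟨m, _, hm⟩, rfl⟩ := hx
    rw [← highPart_add_lowPart m k, ← basis_mul_basis (highPart_mem m k) (lowPart_mem m k),
      ← of_one_mul_of]
    refine Ideal.mul_mem_left _ _ ?_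
    have h := one_of_mul_basis (chi K ((expDeg (lowPart m k) : Fin n → ℤ) + μ)) (lowPart m k) μ
    rw [chi, Pi.single_eq_same, one_smul] at h
    rw [← h]
    refine ideal_mul_mem (chi_mem_ideal_of_neg m _ ?_) _
    rw [Pi.add_apply, coe_expDeg_of_mem_low (lowPart_mem m k), colSum_lowPart le_rfl]
    omega
  | zero => rw [zero_of]; exact zero_mem _
  | add x y _ _ hx hy => rw [add_of]; exact add_mem hx hy
  | smul c x _ hx => rw [smul_of]; exact smul_mem_ideal c hx

lemma mul_one_of_chi (x : CAlg K n) (μ : Fin n → ℤ) : x * of 1 (chi K μ) = of (ev K μ x) (chi K μ) := by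
  induction x using of_induction with
  | h0 => rw [zero_mul, map_zero, zero_of]
  | ht a f => rw [of_mul_one_of, mul_chi, of_smul, ev_of, smul_of]
  | hadd x y hx hy => rw [add_mul, hx, hy, map_add, add_of]

lemma ev_mul (x y : CAlg K n) (μ : Fin n → ℤ) : ev K μ (x * y) = ev K μ (x * of (ev K μ y) (chi K μ)) := by
  rw [← mul_one_of_chi, ← mul_assoc, mul_one_of_chi, ev_of_chi]

lemma indicator_compositions : (compositions n r).indicator (1 : (Fin n → ℤ) → K) =
    ∑ μ ∈ (finite_compositions n r).toFinset, chi K μ := by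
  rw [← indicator_eq_sum, Set.Finite.coe_toFinset]

/-- Since `Λ(n, r)` is finite, `e` is the sum of the `χ_μ`; this splits `x` as `x (1 - e) + x e`. -/
lemma eq_add_sum (r : ℕ) (x : CAlg K n) : x = x * (1 - CAlg.e K n r) +
    ∑ μ ∈ (finite_compositions n r).toFinset, of (ev K μ x) (chi K μ) := by
  have h : CAlg.e K n r = of 1 ((compositions n r).indicator 1) := rfl
  rw [mul_sub, h, indicator_compositions, of_sum, Finset.mul_sum]
  simp only [mul_one_of_chi, mul_one, sub_add_cancel]

/-- The elements of the ideal generated by `1 - e`. -/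
lemma mem_ideal_iff {x : CAlg K n} : x ∈ CAlg.ideal K n r ↔
    ∀ μ ∈ compositions n r, ev K μ x ∈ expSpan K (Bad n μ) := by
  constructor
  · intro hx
    -- Quantifying over right multiples `y` builds in stability on the right; stability on the left
    -- is left-closedness of the bad exponents.
    let J : TwoSidedIdeal (CAlg K n) := TwoSidedIdeal.mk'
      {x | ∀ y : CAlg K n, ∀ μ ∈ compositions n r, ev K μ (x * y) ∈ expSpan K (Bad n μ)}
      (fun y μ _ => by rw [zero_mul, map_zero]; exact zero_mem _)
      (fun hx hx' y μ hμ => by rw [add_mul, map_add]; exact add_mem (hx y μ hμ) (hx' y μ hμ))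
      (fun {x} hx y μ hμ => by
        have h := neg_mem (hx y μ hμ)
        rw [← map_neg] at h
        convert h using 2
        exact neg_mul x y)
      (fun {z x} hx y μ hμ => by
        rw [mul_assoc, ev_mul]
        have h := Submodule.smul_mem (leftIdeal (isLeftClosed_bad (K := K) (le_refl n) μ) μ) z
          ⟨_, hx y μ hμ, rfl⟩
        obtain ⟨a, ha, h⟩ := h
        rw [smul_eq_mul] at h
        rw [h, ev_of_chi]
        exact ha)
      (fun {x z} hx y μ hμ => by rw [mul_assoc]; exact hx _ μ hμ)
    have h : x ∈ J := TwoSidedIdeal.mem_span_iff.mp (TwoSidedIdeal.mem_asIdeal.mp hx) J (by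
      rw [Set.singleton_subset_iff]
      refine (TwoSidedIdeal.mem_mk' _ _ _ _ _ _ _).mpr fun y μ hμ => ?_
      rw [ev_mul, one_sub_e]
      induction ev K μ y using basis_induction with
      | h0 => rw [zero_of, mul_zero, map_zero]; exact zero_mem _
      | ht k =>
        rw [one_of_mul_basis]
        -- A monomial that is not bad has its weight in `Λ(n, r)`, where `1 - e` vanishes.
        by_cases hk : k ∈ Bad n μ
        · rw [map_smul, ev_of_chi]
          exact Submodule.smul_mem _ _ (basis_mem_expSpan hk)
        · simp [expDeg_add_mem_compositions hμ hk]
      | hadd a b ha hb => rw [add_of, mul_add, map_add]; exact add_mem ha hb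
      | hsmul c a ha => rw [smul_of, mul_smul_comm, map_smul]; exact Submodule.smul_mem _ _ ha)
    have h1 := (TwoSidedIdeal.mem_mk' _ _ _ _ _ _ _).mp h 1
    rwa [mul_one] at h1
  · intro hx
    rw [eq_add_sum r x]
    refine add_mem ((CAlg.ideal K n r).mul_mem_left _ one_sub_e_mem) (sum_mem fun μ hμ => ?_)
    exact of_chi_mem_ideal_of_bad (hx μ ((finite_compositions n r).mem_toFinset.mp hμ))

/-- The sum of the left ideal generated by `1 - e` and the left ideals `I χ_μ`. -/
noncomputable def leftSum (K : Type u) [Field K] (n r : ℕ) (s : Finset (Fin n → ℤ)) :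
    Submodule (CAlg K n) (CAlg K n) :=
  Submodule.span (CAlg K n) {1 - CAlg.e K n r} ⊔
    s.sup fun μ => leftIdeal (isLeftClosed_bad (K := K) (le_refl n) μ) μ

lemma leftSum_eq_ideal :
    leftSum K n r (finite_compositions n r).toFinset = CAlg.ideal K n r := by
  refine le_antisymm (sup_le ?_ (Finset.sup_le fun μ _ => ?_)) fun x hx => ?_
  · rw [Submodule.span_singleton_le_iff_mem]
    exact one_sub_e_mem
  · rintro _ ⟨a, ha, rfl⟩
    exact of_chi_mem_ideal_of_bad ha
  · rw [eq_add_sum r x]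
    refine add_mem (Submodule.mem_sup_left (Submodule.smul_mem _ x
      (Submodule.mem_span_singleton_self _))) (Submodule.mem_sup_right (sum_mem fun μ hμ => ?_))
    exact Finset.le_sup (f := fun μ => leftIdeal (isLeftClosed_bad (K := K) (le_refl n) μ) μ) hμ
      ⟨_, mem_ideal_iff.mp hx μ ((finite_compositions n r).mem_toFinset.mp hμ), rfl⟩

/-- Right multiplication by `χ_ν` kills the first submodule and fixes the second. -/
lemma leftSum_inf_leftIdeal {s : Finset (Fin n → ℤ)} {ν : Fin n → ℤ} (hν : ν ∈ compositions n r)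
    (hs : ν ∉ s) :
    leftSum K n r s ⊓ leftIdeal (isLeftClosed_bad (K := K) (le_refl n) ν) ν = ⊥ := by
  rw [eq_bot_iff]
  rintro x ⟨hx, a, ha, rfl⟩
  have h : leftSum K n r s ≤
      LinearMap.ker (LinearMap.toSpanSingleton (CAlg K n) (CAlg K n) (of 1 (chi K ν))) := by
    refine sup_le ?_ (Finset.sup_le fun μ hμ => ?_)
    · rw [Submodule.span_singleton_le_iff_mem, LinearMap.mem_ker, LinearMap.toSpanSingleton_apply,
        smul_eq_mul, one_sub_e, mul_one_of_chi, ev_of]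
      simp [hν, zero_of]
    · rintro _ ⟨b, hb, rfl⟩
      rw [LinearMap.mem_ker, LinearMap.toSpanSingleton_apply, smul_eq_mul, mul_one_of_chi, ev_of,
        chi, Pi.single_eq_of_ne (by rintro rfl; exact hs hμ), zero_smul, zero_of]
  have h1 := LinearMap.mem_ker.mp (h hx)
  rw [LinearMap.toSpanSingleton_apply, smul_eq_mul, mul_one_of_chi, ev_of_chi] at h1
  rw [h1]
  exact zero_mem _

lemma extOrthogonal_leftSum (s : Finset (Fin n → ℤ)) (hs : ∀ μ ∈ s, μ ∈ compositions n r) :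
    ExtOrthogonal.{u} (KilledBy (CAlg.ideal K n r))
      (ModuleCat.of (CAlg K n) (leftSum K n r s)) := by
  induction s using Finset.induction_on with
  | empty =>
    rw [leftSum, Finset.sup_empty, sup_bot_eq]
    exact extOrthogonal_span_idempotent isIdempotentElem_one_sub_e one_sub_e_mem
  | insert ν s hν ih =>
    have h : leftSum K n r (insert ν s) =
        leftSum K n r s ⊔ leftIdeal (isLeftClosed_bad (K := K) (le_refl n) ν) ν := by
      rw [leftSum, Finset.sup_insert, leftSum, sup_assoc, sup_comm (leftIdeal _ _)]
    rw [h]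
    refine ExtOrthogonal.sup (ih fun μ hμ => hs μ (Finset.mem_insert_of_mem hμ))
      (extOrthogonal_leftIdeal_bad chi_mem_ideal_of_neg le_rfl ν) ?_
    rw [leftSum_inf_leftIdeal (hs ν (Finset.mem_insert_self ν s)) hν]
    exact ExtOrthogonal.bot

lemma isStrongIdempotentIdeal_ideal (K : Type u) [Field K] (n r : ℕ) :
    IsStrongIdempotentIdeal (CAlg.ideal K n r) := by
  refine isStrongIdempotentIdeal_of_extOrthogonal _ ?_
  have h := extOrthogonal_leftSum (K := K) (r := r) (finite_compositions n r).toFinset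
    fun μ hμ => (finite_compositions n r).mem_toFinset.mp hμ
  rw [leftSum_eq_ideal] at h
  exact h

end CAlg

/-! ### Exponents and upper triangular matrices. -/

namespace PosRoot

variable {n r : ℕ}

lemma sum_eq_sum_sum (F : Fin n → Fin n → ℤ) : ∑ p : PosRoot n, F p.1.1 p.1.2 =
    ∑ i, ∑ j, if i < j then F i j else 0 := by
  rw [← Fintype.sum_prod_type' (f := fun i j => if i < j then F i j else 0), ← Finset.sum_filter,
    Finset.sum_subtype (p := fun p : Fin n × Fin n => p.1 < p.2) _ (by simp)]

/-- The exponents above the diagonal of a matrix. -/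
def strictPart (M : Matrix (Fin n) (Fin n) ℕ) : PosRoot n → ℕ := fun p => M p.1.1 p.1.2

lemma sum_Iic (M : Matrix (Fin n) (Fin n) ℕ) (j : Fin n) :
    ∑ i ∈ Finset.Iic j, (M i j : ℤ) = M j j + colSum j (strictPart M) := by
  have h : (colSum j (strictPart M) : ℤ) = ∑ i ∈ Finset.Iio j, (M i j : ℤ) := by
    rw [colSum, Nat.cast_sum]
    simp only [Nat.cast_ite, Nat.cast_zero, strictPart]
    rw [sum_eq_sum_sum fun i l => if l = j then (M i l : ℤ) else 0, ← Finset.filter_gt_eq_Iio,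
      Finset.sum_filter]
    refine Finset.sum_congr rfl fun i _ => ?_
    rw [Finset.sum_eq_single j]
    · simp
    · intro l _ hl; simp [hl]
    · simp
  rw [h, ← Finset.Iio_insert, Finset.sum_insert (by simp)]

lemma sum_Ici (M : Matrix (Fin n) (Fin n) ℕ) (i : Fin n) : ∑ j ∈ Finset.Ici i, (M i j : ℤ) =
    M i i + ∑ p : PosRoot n, if p.1.1 = i then (strictPart M p : ℤ) else 0 := by
  have h : (∑ p : PosRoot n, if p.1.1 = i then (strictPart M p : ℤ) else 0) =
      ∑ j ∈ Finset.Ioi i, (M i j : ℤ) := by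
    simp only [strictPart]
    rw [sum_eq_sum_sum fun l j => if l = i then (M l j : ℤ) else 0, ← Finset.filter_lt_eq_Ioi,
      Finset.sum_filter, Finset.sum_eq_single i]
    · simp
    · intro l _ hl; simp [hl]
    · simp
  rw [h, ← Finset.Ioi_insert, Finset.sum_insert (by simp)]

/-- The generators `v_i - v_{i+1}` have partial sums 0 or 1. -/
lemma dominates_add (γ : Psi n) (z : Fin n → ℤ) : Dominates ((γ : Fin n → ℤ) + z) z := by
  intro j
  have h : 0 ≤ ∑ i ∈ Finset.Iic j, (γ : Fin n → ℤ) i := by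
    obtain ⟨γ, hγ⟩ := γ
    induction hγ using AddSubmonoid.closure_induction with
    | mem x hx =>
      obtain ⟨a, b, hab, rfl⟩ := hx
      simp only [Pi.sub_apply, Finset.sum_sub_distrib, Finset.sum_pi_single', Finset.mem_Iic,
        Fin.le_def]
      split_ifs <;> omega
    | zero => simp
    | add x y _ _ hx hy =>
      simp only [Pi.add_apply, Finset.sum_add_distrib]
      exact add_nonneg hx hy
  simp only [Pi.add_apply, Finset.sum_add_distrib]
  omega

/-- The upper triangular matrix with column sums `μ` and exponents `k` above the diagonal. -/
def toMatrix (μ : Fin n → ℤ) (k : PosRoot n → ℕ) : Matrix (Fin n) (Fin n) ℕ := fun i j =>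
  if h : i < j then k ⟨(i, j), h⟩ else if i = j then (μ j - colSum j k).toNat else 0

lemma strictPart_toMatrix (μ : Fin n → ℤ) (k : PosRoot n → ℕ) : strictPart (toMatrix μ k) = k := by
  funext p
  rw [strictPart, toMatrix, dif_pos p.2]

/-- The truncation in `toNat` is harmless exactly because no column sum exceeds `μ`. -/
lemma toMatrix_diag {μ : Fin n → ℤ} {k : PosRoot n → ℕ} (hk : k ∉ CAlg.Bad n μ) (j : Fin n) :
    (toMatrix μ k j j : ℤ) = μ j - colSum j k := by
  have h : (colSum j k : ℤ) ≤ μ j := by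
    by_contra h
    exact hk ⟨j, j.2, not_le.mp h⟩
  rw [toMatrix, dif_neg (lt_irrefl j), if_pos rfl]
  omega

lemma toMatrix_mem {μ : Fin n → ℤ} {k : PosRoot n → ℕ} (hk : k ∉ CAlg.Bad n μ) :
    toMatrix μ k ∈ triMatrices ((expDeg k : Fin n → ℤ) + μ) μ := by
  refine ⟨fun i j hij => ?_, fun i => ?_, fun j => ?_⟩
  · rw [toMatrix, dif_neg hij.not_gt, if_neg hij.ne']
  · rw [sum_Ici, toMatrix_diag hk, strictPart_toMatrix, Pi.add_apply, coe_expDeg]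
    ring
  · rw [sum_Iic, toMatrix_diag hk, strictPart_toMatrix]
    ring

end PosRoot

namespace BasisIndex

variable {n r : ℕ}

open PosRoot

lemma strictPart_notMem_bad (x : BasisIndex n r) : strictPart x.1.2.2 ∉ CAlg.Bad n x.1.2.1 := by
  rintro ⟨j, _, hj⟩
  rw [← x.2.2.2.2.2.2 j, sum_Iic] at hj
  omega

/-- The column sums recover the diagonal, and the full matrix recovers the row sums. -/
lemma ext_strictPart {x y : BasisIndex n r} (h : x.1.2.1 = y.1.2.1)
    (h' : strictPart x.1.2.2 = strictPart y.1.2.2) : x = y := by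
  have hM : x.1.2.2 = y.1.2.2 := by
    ext i j
    rcases lt_trichotomy i j with hij | rfl | hij
    · exact congrFun h' ⟨(i, j), hij⟩
    · have h1 := x.2.2.2.2.2.2 i
      have h2 := y.2.2.2.2.2.2 i
      rw [sum_Iic] at h1 h2
      rw [h', h] at h1
      omega
    · rw [x.2.2.2.2.1 i j hij, y.2.2.2.2.1 i j hij]
  refine Subtype.ext (Prod.ext (funext fun i => ?_) (Prod.ext h hM))
  rw [← x.2.2.2.2.2.1 i, ← y.2.2.2.2.2.1 i, hM]

/-- The index with column sums `μ` and exponents `k` above the diagonal. -/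
noncomputable def ofExp {μ : Fin n → ℤ} (hμ : μ ∈ compositions n r) {k : PosRoot n → ℕ}
    (hk : k ∉ CAlg.Bad n μ) : BasisIndex n r :=
  ⟨((expDeg k : Fin n → ℤ) + μ, μ, toMatrix μ k), CAlg.expDeg_add_mem_compositions hμ hk, hμ,
    dominates_add _ _, toMatrix_mem hk⟩

end BasisIndex

/-! ### The basis of the quotient. -/

namespace CLambda

variable {K : Type u} [Field K] {n r : ℕ}

open PosRoot KostantAlg CAlg

lemma basisElement_eq (x : BasisIndex n r) : CLambda.basisElement K x =
    Ideal.Quotient.mk (CAlg.ideal K n r) (of (basis K n (strictPart x.1.2.2)) (chi K x.1.2.1)) := by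
  rw [CLambda.basisElement, monomial_eq_basis]
  rfl

/-- A relation modulo the ideal has its value at each `μ` in the bad span, whereas the exponents of
the index set are not bad; comparing PBW coordinates gives zero coefficients. -/
lemma linearIndependent_basisElement :
    LinearIndependent K (CLambda.basisElement K : BasisIndex n r → CLambda K n r) := by
  rw [linearIndependent_iff']
  intro s g hg x hx
  have h1 : ∑ y ∈ s, g y • of (basis K n (strictPart y.1.2.2)) (chi K y.1.2.1) ∈
      CAlg.ideal K n r := by
    rw [← Ideal.Quotient.eq_zero_iff_mem, ← hg, map_sum]
    refine Finset.sum_congr rfl fun y _ => ?_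
    rw [basisElement_eq]
    rfl
  have h2 := mem_ideal_iff.mp h1 x.1.2.1 x.2.2.1
  have h3 : (basis K n).repr (ev K x.1.2.1
      (∑ y ∈ s, g y • of (basis K n (strictPart y.1.2.2)) (chi K y.1.2.1)))
      (strictPart x.1.2.2) = 0 := by
    by_contra h
    exact x.strictPart_notMem_bad (mem_expSpan.mp h2 (Finsupp.mem_support_iff.mpr h))
  rw [map_sum, map_sum, Finsupp.finsetSum_apply, Finset.sum_eq_single x] at h3
  · rw [map_smul, ev_of_chi, map_smul, Module.Basis.repr_self, Finsupp.smul_apply,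
      Finsupp.single_eq_same, smul_eq_mul, mul_one] at h3
    exact h3
  · intro y _ hy
    rw [map_smul, ev_of, map_smul, map_smul, Module.Basis.repr_self, Finsupp.smul_apply,
      Finsupp.smul_apply]
    by_cases h : x.1.2.1 = y.1.2.1
    · rw [Finsupp.single_eq_of_ne, smul_zero, smul_zero]
      exact fun h' => hy (BasisIndex.ext_strictPart h h').symm
    · rw [chi, Pi.single_eq_of_ne h, zero_smul, smul_zero]
  · exact fun h => absurd hx h

/-- Modulo the ideal only the terms `a χ_μ` with `μ` in `Λ(n, r)` survive, and among the PBW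
monomials in `a` only those that are not bad. -/
lemma span_basisElement : Submodule.span K
    (Set.range (CLambda.basisElement K : BasisIndex n r → CLambda K n r)) = ⊤ := by
  rw [eq_top_iff]
  rintro y -
  obtain ⟨x, rfl⟩ := Ideal.Quotient.mk_surjective y
  rw [eq_add_sum r x, map_add, Ideal.Quotient.eq_zero_iff_mem.mpr
    ((CAlg.ideal K n r).mul_mem_left x one_sub_e_mem), zero_add, map_sum]
  refine sum_mem fun μ hμ => ?_
  have hμ := (finite_compositions n r).mem_toFinset.mp hμ
  induction ev K μ x using basis_induction with
  | h0 => rw [zero_of, map_zero]; exact zero_mem _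
  | ht k =>
    by_cases hk : k ∈ Bad n μ
    · rw [Ideal.Quotient.eq_zero_iff_mem.mpr (of_chi_mem_ideal_of_bad (basis_mem_expSpan hk))]
      exact zero_mem _
    · refine Submodule.subset_span ⟨BasisIndex.ofExp hμ hk, ?_⟩
      rw [basisElement_eq, BasisIndex.ofExp]
      simp only [strictPart_toMatrix]
  | hadd a b ha hb => rw [add_of, map_add]; exact add_mem ha hb
  | hsmul c a ha =>
    rw [smul_of]
    exact Submodule.smul_mem _ c ha

end CLambda

theorem mainTheorem2 (K : Type u) [Field K] (n r : ℕ) :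
    IsStrongIdempotentIdeal (CAlg.ideal K n r) ∧
      LinearIndependent K (CLambda.basisElement K : BasisIndex n r → CLambda K n r) ∧
      Submodule.span K (Set.range (CLambda.basisElement K : BasisIndex n r → CLambda K n r)) =
        ⊤ :=
  ⟨CAlg.isStrongIdempotentIdeal_ideal K n r, CLambda.linearIndependent_basisElement,
    CLambda.span_basisElement⟩
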